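/- Let $n\ge 0$ and let $a_1,\dots,a_n$ be positive integers. Let $e,f$ be the standard raising and lowering generators of $\mathfrak{sl}_2=\mathfrak{sl}_2(\mathbb C)$, let $e_k=e\otimes t^k\in\mathfrak{sl}_2\otimes\mathbb C[t]$, and let $\mathcal A_n$ be the abelian Lie algebra with basis $e_0,\dots,e_{n-1}$. Let $\Sigma\subset\mathbb C^n$ be the set of points with pairwise distinct coordinates. For $Z=(z_1,\dots,z_n)\in\Sigma$ let $I(Z)\subset\mathbb C[e_0,\dots,e_{n-1}]$ be the kernel of the algebra homomorphism $$\mathbb C[e_0,\dots,e_{n-1}]\to\mathbb C[y_1,\dots,y_n]/(y_1^{a_1},\dots,y_n^{a_n}),\qquad e_k\mapsto\sum_{i=1}^n z_i^k y_i .$$ An ideal $I_0$ is called the limit of $I(Z)$ as $Z\to0$, $Z\in\Sigma$, if for every $d\ge 0$ the spaces of elements of degree at most $d$ in $I(Z)$ (where $\deg e_k=1$) converge, in the Grassmannian of subspaces of the finite-dimensional space of polynomials of degree at most $d$, to the space of elements of degree at most $d$ in $I_0$. Let $\pi_1,\dots,\pi_n$ be irreducible finite-dimensional $\mathfrak{sl}_2$-modules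 with $\dim\pi_i=a_i$. Let $u_i\in\pi_i$ be a highest vector, meaning here $u_i\neq0$ and $f u_i=0$ (so that $e$ generates $\pi_i$ from $u_i$), and let $u=u_1\otimes\cdots\otimes u_n$. Let $\pi_i(z_i)$ be the $\mathfrak{sl}_2\otimes\mathbb C[t]$-module $\pi_i$ on which $x\otimes t^k$ acts as $z_i^k x$. For $Z\in\Sigma$ filter $\pi_1(z_1)\otimes\cdots\otimes\pi_n(z_n)$ by $$F_s=\operatorname{span}\{e_{i_1}\cdots e_{i_k}u:\ k\ge 0,\ i_1,\dots,i_k\ge0,\ i_1+\cdots+i_k\le s\}.$$ The fusion product is the associated graded space $F_0\oplus\bigoplus_{s\ge0}F_{s+1}/F_s$, on which $e_k$ acts by the induced maps $F_s/F_{s-1}\to F_{s+k}/F_{s+k-1}$ (with $F_{-1}=0$). Theorem. The limit $I(0)=\lim_{Z\to0,\,Z\in\Sigma}I(Z)$ exists and is unique; it depends only on $a_1,\dots,a_n$. For all such $\pi_i$ and $u_i$ and for every $Z\in\Sigma$, the fusion product is isomorphic, as an $\mathcal A_n$-module, to $\mathbb C[e_0,\dots,e_{n-1}]/I(0)$, where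 $e_k$ acts on the quotient by multiplication. In particular, for any two points of $\Sigma$ the fusion products are isomorphic as $\mathcal A_n$-modules. -/

import Mathlib

open scoped TensorProduct DirectSum

noncomputable section

namespace Fusion

universe u

-- Endomorphism algebras are regarded as Lie algebras with the commutator bracket.
attribute [local instance 100] LieRing.ofAssociativeRing

/-! ### The current algebra and evaluation representations -/

/-- The Lie algebra `sl_2(ℂ)` of traceless `2 × 2` matrices. -/
abbrev sl2 : Type := LieAlgebra.SpecialLinear.sl (Fin 2) ℂ

/-- The raising generator `e`, the matrix unit in position `(0, 1)`; it spans `𝔫`. -/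
def e : sl2 := LieAlgebra.SpecialLinear.single 0 1 (by decide) 1

/-- The lowering generator `f`, the matrix unit in position `(1, 0)`; it spans `𝔫₋`. -/
def f : sl2 := LieAlgebra.SpecialLinear.single 1 0 (by decide) 1

/-- The current algebra `sl_2 ⊗ ℂ[t]`, a Lie algebra over `ℂ` with
`[p ⊗ x, q ⊗ y] = p q ⊗ [x, y]`. -/
abbrev Current : Type := Polynomial ℂ ⊗[ℂ] sl2

/-- The element `e_k = e ⊗ t^k` of the current algebra. -/
def eCur (k : ℕ) : Current := (Polynomial.X ^ k : Polynomial ℂ) ⊗ₜ[ℂ] e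

/-- The evaluation homomorphism `τ_z : sl_2 ⊗ ℂ[t] → sl_2`, `x ⊗ p ↦ p(z) x`. -/
def evalHom (z : ℂ) : Current →ₗ⁅ℂ⁆ sl2 where
  toLinearMap := (TensorProduct.lid ℂ sl2).toLinearMap ∘ₗ
    TensorProduct.map (Polynomial.aeval z).toLinearMap LinearMap.id
  map_lie' := by
    intro x y
    induction x using TensorProduct.induction_on with
    | zero => simp
    | add x₁ x₂ h₁ h₂ => simp_all [add_lie]
    | tmul p x =>
      induction y using TensorProduct.induction_on with
      | zero => simp
      | add y₁ y₂ h₁ h₂ => simp_all [lie_add]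
      | tmul q y => simp [LieAlgebra.ExtendScalars.bracket_tmul, mul_smul,
        smul_comm (Polynomial.eval z p)]

/-- The evaluation representation `π(z)`, as a homomorphism into `End π`: the pull-back of the
`sl_2`-module `π` along `τ_z`, so that `x t^k · v = z^k x · v`. -/
def evalRep (π : Type u) [AddCommGroup π] [Module ℂ π] [LieRingModule sl2 π]
    [LieModule ℂ sl2 π] (z : ℂ) : Current →ₗ⁅ℂ⁆ Module.End ℂ π :=
  (LieModule.toEnd ℂ sl2 π).comp (evalHom z)

section Tensor

variable {n : ℕ} (π : Fin n → Type u) [∀ i, AddCommGroup (π i)] [∀ i, Module ℂ (π i)]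

/-- `A ↦ 1 ⊗ ⋯ ⊗ A ⊗ ⋯ ⊗ 1`, with `A` in position `i`. -/
def atFactor (i : Fin n) : Module.End ℂ (π i) →ₗ[ℂ] Module.End ℂ (⨂[ℂ] i, π i) :=
  (PiTensorProduct.mapMultilinear ℂ π π).toLinearMap (fun _ => LinearMap.id) i

theorem atFactor_eq (i : Fin n) (A : Module.End ℂ (π i)) :
    atFactor π i A = PiTensorProduct.mapMonoidHom (Pi.mulSingle i A) := rfl

theorem atFactor_mul (i : Fin n) (A B : Module.End ℂ (π i)) :
    atFactor π i (A * B) = atFactor π i A * atFactor π i B := by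
  rw [atFactor_eq, atFactor_eq, atFactor_eq, Pi.mulSingle_mul, map_mul]

theorem atFactor_comm {i j : Fin n} (h : i ≠ j) (A : Module.End ℂ (π i))
    (B : Module.End ℂ (π j)) :
    atFactor π i A * atFactor π j B = atFactor π j B * atFactor π i A := by
  rw [atFactor_eq, atFactor_eq, ← map_mul, ← map_mul]
  exact congrArg _ (Pi.mulSingle_commute (f := fun i => Module.End ℂ (π i)) h A B).eq

variable [∀ i, LieRingModule sl2 (π i)] [∀ i, LieModule ℂ sl2 (π i)]

/-- The tensor product `π_1(z_1) ⊗ ⋯ ⊗ π_n(z_n)` of evaluation representations of the current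
algebra, as a homomorphism into the endomorphisms of `π_1 ⊗ ⋯ ⊗ π_n`. -/
def tensorRep (z : Fin n → ℂ) : Current →ₗ⁅ℂ⁆ Module.End ℂ (⨂[ℂ] i, π i) where
  toLinearMap := ∑ i, atFactor π i ∘ₗ (evalRep (π i) (z i)).toLinearMap
  map_lie' := by
    intro x y
    simp only [AddHom.toFun_eq_coe, LinearMap.coe_toAddHom, LinearMap.sum_apply,
      LinearMap.comp_apply, LieHom.coe_toLinearMap, LieHom.map_lie, Ring.lie_def, map_sub,
      atFactor_mul, Finset.sum_mul_sum]
    rw [Finset.sum_comm (f := fun i j => atFactor π i (evalRep (π i) (z i) y) *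
      atFactor π j (evalRep (π j) (z j) x)), ← Finset.sum_sub_distrib]
    refine Finset.sum_congr rfl fun i _ => ?_
    rw [← Finset.sum_sub_distrib]
    rw [Finset.sum_eq_single i]
    · intro j _ hj
      rw [atFactor_comm π hj.symm, sub_self]
    · simp

/-- The operator by which `e_k = e ⊗ t^k` acts on `π_1(z_1) ⊗ ⋯ ⊗ π_n(z_n)`. -/
def eOp (z : Fin n → ℂ) (k : ℕ) : Module.End ℂ (⨂[ℂ] i, π i) := tensorRep π z (eCur k)

/-! ### The fusion product -/

variable {π}

/-- `v` is a highest vector: a nonzero vector annihilated by `𝔫₋`. (This is the convention in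
which `𝔫 = ℂ e` generates the module from its highest vector.) -/
def IsHighestVector {M : Type u} [AddCommGroup M] [LieRingModule sl2 M] (v : M) : Prop :=
  v ≠ 0 ∧ ⁅f, v⁆ = 0

/-- `F_s`, the span of all `e_{i_1} ⋯ e_{i_k} u` with `k ≥ 0`, `i_j ≥ 0` and `∑ i_j ≤ s`, where
`u = u_1 ⊗ ⋯ ⊗ u_n`. -/
def filt (z : Fin n → ℂ) (u : ∀ i, π i) (s : ℕ) : Submodule ℂ (⨂[ℂ] i, π i) :=
  Submodule.span ℂ {w | ∃ L : List ℕ, L.sum ≤ s ∧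
    w = (L.map (eOp π z)).prod (PiTensorProduct.tprod ℂ u)}

/-- The step of the filtration before `F_s`: it is `0` for `s = 0`, and `F_{s-1}` for `s > 0`. -/
def filtPrev (z : Fin n → ℂ) (u : ∀ i, π i) : ℕ → Submodule ℂ (⨂[ℂ] i, π i)
  | 0 => ⊥
  | s + 1 => filt z u s

/-- The component of degree `s` of the associated graded space: `F_0` (modulo `0`) for `s = 0`,
and `F_s / F_{s-1}` for `s > 0`. -/
abbrev GrPiece (z : Fin n → ℂ) (u : ∀ i, π i) (s : ℕ) : Type u :=
  filt z u s ⧸ (filtPrev z u s).submoduleOf (filt z u s)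

/-- The fusion product: the associated graded space `F_0 ⊕ ⨁_{s ≥ 0} F_{s+1} / F_s`. -/
abbrev FusionProduct (z : Fin n → ℂ) (u : ∀ i, π i) : Type u :=
  ⨁ s : ℕ, GrPiece z u s

theorem eOp_mem_filt (z : Fin n → ℂ) (u : ∀ i, π i) (k s : ℕ) :
    ∀ w ∈ filt z u s, eOp π z k w ∈ filt z u (s + k) := by
  intro w hw
  refine (Submodule.span_le (p := (filt z u (s + k)).comap (eOp π z k))).2 ?_ hw
  rintro _ ⟨L, hL, rfl⟩
  refine Submodule.subset_span ⟨k :: L, ?_, ?_⟩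
  · rw [List.sum_cons]; omega
  · rw [List.map_cons, List.prod_cons]; rfl

theorem eOp_mem_filtPrev (z : Fin n → ℂ) (u : ∀ i, π i) (k s : ℕ) :
    ∀ w ∈ filtPrev z u s, eOp π z k w ∈ filtPrev z u (s + k) := by
  intro w hw
  cases s with
  | zero =>
    have h : w = 0 := hw
    rw [h, map_zero]
    exact zero_mem _
  | succ s =>
    rw [Nat.add_right_comm]
    exact eOp_mem_filt z u k s w hw

/-- The map `F_s / F_{s-1} → F_{s+k} / F_{s+k-1}` induced by `e_k`. -/
def grE (z : Fin n → ℂ) (u : ∀ i, π i) (k s : ℕ) :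
    GrPiece z u s →ₗ[ℂ] GrPiece z u (s + k) :=
  Submodule.mapQ _ _ ((eOp π z k).restrict (eOp_mem_filt z u k s))
    (fun w hw => eOp_mem_filtPrev z u k s w hw)

/-- The action of `e_k` on the fusion product; it raises the degree by `k`. -/
def fusionE (z : Fin n → ℂ) (u : ∀ i, π i) (k : ℕ) : Module.End ℂ (FusionProduct z u) :=
  DirectSum.toModule ℂ ℕ (FusionProduct z u)
    (fun s => DirectSum.lof ℂ ℕ (GrPiece z u) (s + k) ∘ₗ grE z u k s)

end Tensor

/-! ### The ideals `I(Z)` and their limit -/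

variable {n : ℕ}

/-- The algebra `ℂ[y_1, …, y_n] / (y_1^{a_1}, …, y_n^{a_n}) = ⨂ ℂ[y_i] / (y_i^{a_i})`. -/
abbrev TruncAlg (a : Fin n → ℕ) : Type :=
  MvPolynomial (Fin n) ℂ ⧸ Ideal.span (Set.range fun i => (MvPolynomial.X i : MvPolynomial (Fin n) ℂ) ^ a i)

/-- The ideal `I(Z)` of `ℂ[e_0, …, e_{n-1}]`: the kernel of the homomorphism to
`ℂ[y_1, …, y_n] / (y_i^{a_i})` that sends `e_k` to `∑ i, z_i ^ k y_i`. -/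
def idealI (a : Fin n → ℕ) (z : Fin n → ℂ) : Ideal (MvPolynomial (Fin n) ℂ) :=
  RingHom.ker (MvPolynomial.aeval (R := ℂ) (S₁ := TruncAlg a) fun k : Fin n =>
    ∑ i, (z i ^ (k : ℕ)) • Ideal.Quotient.mk _ (MvPolynomial.X i))

/-- The finite-dimensional space of elements of degree at most `d` in an ideal. -/
def degLE (I : Ideal (MvPolynomial (Fin n) ℂ)) (d : ℕ) : Submodule ℂ (MvPolynomial (Fin n) ℂ) :=
  I.restrictScalars ℂ ⊓ MvPolynomial.restrictTotalDegree (Fin n) ℂ d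

/-- Convergence of a family `W` of subspaces of `ℂ[e_0, …, e_{n-1}]` to `W₀` along the filter `l`,
for subspaces of some finite-dimensional space of polynomials. This is convergence in the
Grassmannian: the dimension of `W x` is eventually that of `W₀`, and every element of `W₀` is a
limit (coefficient by coefficient) of elements of the `W x`. -/
def GrassmannTendsto {X : Type*} (W : X → Submodule ℂ (MvPolynomial (Fin n) ℂ)) (l : Filter X)
    (W₀ : Submodule ℂ (MvPolynomial (Fin n) ℂ)) : Prop :=
  (∀ᶠ x in l, Module.finrank ℂ (W x) = Module.finrank ℂ W₀) ∧
    ∀ p ∈ W₀, ∃ q : X → MvPolynomial (Fin n) ℂ, (∀ᶠ x in l, q x ∈ W x) ∧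
      ∀ m, Filter.Tendsto (fun x => (q x).coeff m) l (nhds (p.coeff m))

/-- `I₀` is the limit of the ideals `I(Z)` as `Z → 0` through points with pairwise distinct
coordinates: in each bounded degree `≤ d`, the subspaces converge in the Grassmannian. -/
def IsLimitIdeal (a : Fin n → ℕ) (I₀ : Ideal (MvPolynomial (Fin n) ℂ)) : Prop :=
  ∀ d : ℕ, GrassmannTendsto (fun z : Fin n → ℂ => degLE (idealI a z) d)
    (nhdsWithin 0 {z | Function.Injective z}) (degLE I₀ d)

end Fusion

end

/-! Put e(T) = ∑ e_k T^k and b_i = a_i - 1. The image of e(T) for a point Z is the rational function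
∑ y_i / (1 - z_i T). Since y_i^{a_i} = 0, its r-th power multiplied by ∏ (1 - z_i T)^{min(r, b_i)}
is a polynomial of degree at most ∑ min(r, b_i) - r (`coeff_pow_mul_denom_eq_zero`). There are two
ways to replace the denominator by 1. As Z → 0 it tends to 1. In the associated graded space its
higher coefficients drop out, because they multiply terms of smaller weight. Either way the same
relations appear, free of Z: the coefficient of T^t in e(T)^r is zero whenever t + r > ∑ min(r,
b_i). They generate `limitIdeal a`, so this ideal consists of limits of elements of I(Z), and every
fusion product is a quotient of ℂ[e_0, …, e_{n-1}] / `limitIdeal a`.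

Dimensions show that nothing more is killed. For distinct z_i the Vandermonde matrix recovers each
y_i from the e_k, so I(Z) has codimension at least ∏ a_i in large degree and the filtration exhausts
the tensor product, whose dimension is ∏ a_i. It remains to bound the quotient by `limitIdeal a`
from above by ∏ a_i; this is `rank_quotient_relIdeal_le`.

That bound is a recursion on the parts ξ_i = a_i - 1. Let b + 1 ≤ c be the two smallest parts, η the
others, and g the (b+1)-st power of the top generator. Modulo g the relations for (b, c + 1, η) hold
(`Relations.of_top_pow_eq_zero`), and the annihilator of g contains those for (c - b - 1, η)
(`Relations.top_pow_mul`). The product ∏ (ξ_i + 1) satisfies the same recursion with equality. The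
annihilator statement is the delicate one; it rests on Euler's identity for powers of e(T). -/

noncomputable section

namespace Fusion

universe u

attribute [local instance 100] LieRing.ofAssociativeRing

/-! ### Powers of truncated generating polynomials -/

section Window

open Polynomial

variable {B : Type*} [CommRing B]

/-- The polynomial `∑ e_i T^i` over `k ≤ i < n`. -/
def window (e : ℕ → B) (k n : ℕ) : B[X] := ∑ i ∈ Finset.Ico k n, C (e i) * X ^ i

theorem window_natDegree_le (e : ℕ → B) (k n : ℕ) : (window e k (n + 1)).natDegree ≤ n := by
  refine natDegree_sum_le_of_forall_le _ _ fun i hi => ?_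
  exact (natDegree_C_mul_X_pow_le _ _).trans (by have := Finset.mem_Ico.1 hi; omega)

theorem window_coeff (e : ℕ → B) (k n j : ℕ) :
    (window e k n).coeff j = if k ≤ j ∧ j < n then e j else 0 := by
  simp [window, coeff_C_mul, coeff_X_pow]

theorem window_eq_add_left (e : ℕ → B) {k n : ℕ} (h : k < n) :
    window e k n = window e (k + 1) n + C (e k) * X ^ k := by
  rw [window, Finset.sum_eq_sum_Ico_succ_bot h, add_comm, window]

theorem window_eq_add_right (e : ℕ → B) {k n : ℕ} (h : k ≤ n) :
    window e k (n + 1) = window e k n + C (e n) * X ^ n := by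
  rw [window, Finset.sum_Ico_succ_top h, window]

/-- Adding a monomial of low degree preserves the vanishing of `x * [T^t] A^r` above a line. -/
theorem mul_coeff_pow_add_monomial {A : B[X]} (a : B) {x : B} {k l c m : ℕ} (hl : l < k)
    (h : ∀ r t, r * k + c < t + r + m → x * (A ^ r).coeff t = 0)
    (r t : ℕ) (hrt : r * k + c < t + r + m) :
    x * ((A + C a * X ^ l) ^ r).coeff t = 0 := by
  rw [add_pow, finsetSum_coeff, Finset.mul_sum]
  refine Finset.sum_eq_zero fun j hj => ?_
  have hj' : j ≤ r := by have := Finset.mem_range.1 hj; omega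
  have h1 : A ^ j * (C a * X ^ l) ^ (r - j) * ((r.choose j : ℕ) : B[X]) =
      C (a ^ (r - j) * (r.choose j : ℕ)) * (A ^ j * X ^ (l * (r - j))) := by
    rw [mul_pow, ← pow_mul, C_mul, C_pow, C_eq_natCast]; ring
  rw [h1, coeff_C_mul, coeff_mul_X_pow']
  split_ifs with hd
  · obtain ⟨q, rfl⟩ := Nat.exists_eq_add_of_le hj'
    rw [mul_left_comm, h j _ ?_, mul_zero]
    simp only [Nat.add_sub_cancel_left] at hd ⊢
    -- Trading q factors of A for q copies of the monomial shifts the degree by q l, while the line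
    -- moves by q (k - 1); as l ≤ k - 1 the remaining factor still lies above the line.
    have : q * (l + 1) ≤ q * k := Nat.mul_le_mul_left _ hl
    obtain ⟨s, rfl⟩ := Nat.exists_eq_add_of_le hd
    rw [Nat.add_sub_cancel_left]
    nlinarith
  · simp

theorem coeff_mul_window (e : ℕ → B) (k n t : ℕ) (F : B[X]) :
    (F * window e k (n + 1)).coeff (t + n) =
      ∑ j ∈ Finset.Ico k (n + 1), e j * F.coeff (t + n - j) := by
  rw [window, Finset.mul_sum, finsetSum_coeff]
  refine Finset.sum_congr rfl fun j hj => ?_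
  have := Finset.mem_Ico.1 hj
  rw [mul_left_comm, coeff_C_mul, coeff_mul_X_pow', if_pos (by omega)]

theorem coeff_mul_X_mul_derivative_window (e : ℕ → B) (k n t : ℕ) (F : B[X]) :
    (F * (X * derivative (window e k (n + 1)))).coeff (t + n) =
      ∑ j ∈ Finset.Ico k (n + 1), (j : B) * (e j * F.coeff (t + n - j)) := by
  have : X * derivative (window e k (n + 1)) = window (fun j => (j : B) * e j) k (n + 1) := by
    ext j
    rcases j with _ | j
    · simp [window_coeff]
    · rw [coeff_X_mul, coeff_derivative, window_coeff, window_coeff]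
      split_ifs <;> push_cast <;> ring
  rw [this, coeff_mul_window]
  simp [mul_assoc]

theorem coeff_X_mul_derivative (F : B[X]) (t : ℕ) :
    (X * derivative F).coeff t = t * F.coeff t := by
  rcases t with _ | t
  · simp
  · rw [coeff_X_mul, coeff_derivative]; push_cast; ring

/-- The Euler identity for powers of `window e k (N + 2)`. -/
theorem sum_sub_mul_coeff_window_pow (e : ℕ → B) (k N r t : ℕ) :
    ((r : B) + 1) * ∑ j ∈ Finset.Ico k (N + 2),
        ((j : B) - N) * (e j * (window e k (N + 2) ^ r).coeff (t + (N + 1) - j)) =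
      ((t : B) + (N + 1) - N * (r + 1)) * (window e k (N + 2) ^ (r + 1)).coeff (t + (N + 1)) := by
  have h1 := coeff_X_mul_derivative (window e k (N + 2) ^ (r + 1)) (t + (N + 1))
  rw [derivative_pow_succ] at h1
  have h2 : X * (C ((r : B) + 1) * window e k (N + 2) ^ r * derivative (window e k (N + 2))) =
    C ((r : B) + 1) * (window e k (N + 2) ^ r * (X * derivative (window e k (N + 2)))) := by ring
  rw [h2, coeff_C_mul, coeff_mul_X_mul_derivative_window] at h1
  have h3 := coeff_mul_window e k (N + 1) t (window e k (N + 2) ^ r)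
  rw [← pow_succ] at h3
  simp_rw [sub_mul, Finset.sum_sub_distrib, mul_sub]
  rw [h1, ← Finset.mul_sum, ← h3]
  push_cast
  ring

variable [Algebra ℂ B]

theorem eq_zero_of_natCast_add_one_mul {r : ℕ} {x : B} (h : ((r : B) + 1) * x = 0) : x = 0 := by
  have h0 : ((r : ℂ) + 1) ≠ 0 := by exact_mod_cast Nat.succ_ne_zero r
  have h1 : ((r : ℂ) + 1) • x = 0 := by
    rw [Algebra.smul_def, map_add, map_natCast, map_one, h]
  exact (smul_eq_zero_iff_right h0).1 h1

/-- Each factor e_{N+1} lowers the vanishing line by 2. In the Euler identity the weight j - N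
removes the term j = N, the term j = N + 1 is the wanted one, and the terms j < N involve
coefficients of T^s with s ≥ t + 2, which vanish by induction. The right-hand side vanishes by
induction too, because k ≤ N. -/
theorem top_pow_mul_coeff_window_pow (e : ℕ → B) {N k c : ℕ} (hk : k ≤ N)
    (h : ∀ r t, r * k + c < t + r → (window e k (N + 2) ^ r).coeff t = 0) (i : ℕ) :
    ∀ r t, r * k + c < t + r + 2 * i → e (N + 1) ^ i * (window e k (N + 2) ^ r).coeff t = 0 := by
  induction i with
  | zero => intro r t hrt; rw [h r t (by omega), mul_zero]
  | succ i ih =>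
    intro r t hrt
    have key := congrArg (e (N + 1) ^ i * ·) (sum_sub_mul_coeff_window_pow e k N r t)
    rw [mul_left_comm, mul_left_comm (e (N + 1) ^ i), ih (r + 1) _ (by nlinarith), mul_zero,
      Finset.mul_sum] at key
    have key := eq_zero_of_natCast_add_one_mul key
    rw [Finset.sum_eq_single (N + 1)] at key
    · rw [Nat.add_sub_cancel, Nat.cast_add, Nat.cast_one, add_sub_cancel_left, one_mul,
        ← mul_assoc, ← pow_succ] at key
      exact key
    · intro j hj hj'
      have := Finset.mem_Ico.1 hj
      rcases eq_or_ne j N with rfl | hjN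
      · simp
      · rw [mul_left_comm, mul_left_comm (e (N + 1) ^ i), ih r _ (by omega)]
        simp
    · intro h'
      exact absurd (Finset.mem_Ico.2 ⟨by omega, by omega⟩) h'

/-- The monomials of degree below k can be removed from and restored to e(T) without disturbing a
vanishing line of slope k - 1. So strip them, multiply by the top powers, and put them back. -/
theorem top_pow_mul_coeff_window_zero_pow (e : ℕ → B) {N k c : ℕ} (hk : k ≤ N)
    (h : ∀ r t, r * k + c < t + r → (window e 0 (N + 2) ^ r).coeff t = 0) (b r t : ℕ)
    (hrt : r * k + c < t + r + 2 * b) :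
    e (N + 1) ^ b * (window e 0 (N + 2) ^ r).coeff t = 0 := by
  have down : ∀ l ≤ k, ∀ r t, r * k + c < t + r → (window e l (N + 2) ^ r).coeff t = 0 := by
    intro l
    induction l with
    | zero => exact fun _ => h
    | succ l ih =>
      intro hl r t hrt
      have h1 := mul_coeff_pow_add_monomial (A := window e l (N + 2)) (-e l) (x := 1) (k := k)
        (l := l) (c := c) (m := 0) (by omega)
        (fun r t hrt => by rw [ih (by omega) r t (by omega), mul_zero]) r t (by omega)
      rwa [window_eq_add_left e (by omega : l < N + 2), C_neg, neg_mul, add_neg_cancel_right,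
        one_mul] at h1
  have up : ∀ i ≤ k, ∀ r t, r * k + c < t + r + 2 * b →
      e (N + 1) ^ b * (window e (k - i) (N + 2) ^ r).coeff t = 0 := by
    intro i
    induction i with
    | zero => exact fun _ => top_pow_mul_coeff_window_pow e hk (down k le_rfl) b
    | succ i ih =>
      intro hi r t hrt
      rw [window_eq_add_left e (by omega : k - (i + 1) < N + 2)]
      refine mul_coeff_pow_add_monomial _ (k := k) (c := c) (m := 2 * b) (by omega) ?_ r t hrt
      rw [show k - (i + 1) + 1 = k - i by omega]
      exact ih (by omega)
  have := up k le_rfl r t hrt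
  rwa [Nat.sub_self] at this

end Window

/-! ### The relations of the fusion product -/

/-- `∑ min(r, ξ_j)` over the members `ξ_j` of `ξ`. -/
def capSum (ξ : Multiset ℕ) (r : ℕ) : ℕ := (ξ.map (min r)).sum

@[simp] theorem capSum_cons (x : ℕ) (ξ : Multiset ℕ) (r : ℕ) :
    capSum (x ::ₘ ξ) r = min r x + capSum ξ r := by
  simp [capSum]

@[simp] theorem capSum_zero (r : ℕ) : capSum 0 r = 0 := rfl

theorem capSum_add (ξ η : Multiset ℕ) (r : ℕ) : capSum (ξ + η) r = capSum ξ r + capSum η r := by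
  simp [capSum]

theorem capSum_le_mul_card (ξ : Multiset ℕ) (r : ℕ) : capSum ξ r ≤ r * Multiset.card ξ := by
  induction ξ using Multiset.induction with
  | empty => simp
  | cons x ξ ih => rw [capSum_cons, Multiset.card_cons, Nat.mul_succ]; omega

theorem capSum_le_sum (ξ : Multiset ℕ) (r : ℕ) : capSum ξ r ≤ ξ.sum := by
  induction ξ using Multiset.induction with
  | empty => simp
  | cons x ξ ih => rw [capSum_cons, Multiset.sum_cons]; omega

theorem capSum_eq_mul_card {ξ : Multiset ℕ} {r : ℕ} (h : ∀ x ∈ ξ, r ≤ x) :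
    capSum ξ r = r * Multiset.card ξ := by
  induction ξ using Multiset.induction with
  | empty => simp
  | cons x ξ ih =>
    rw [capSum_cons, Multiset.card_cons, Nat.mul_succ,
      ih fun y hy => h y (Multiset.mem_cons_of_mem hy), min_eq_left (h x (Multiset.mem_cons_self _ _)),
      add_comm]

theorem capSum_eq_sum {ξ : Multiset ℕ} {r : ℕ} (h : ∀ x ∈ ξ, x ≤ r) : capSum ξ r = ξ.sum := by
  induction ξ using Multiset.induction with
  | empty => simp
  | cons x ξ ih =>
    rw [capSum_cons, Multiset.sum_cons, ih fun y hy => h y (Multiset.mem_cons_of_mem hy),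
      min_eq_right (h x (Multiset.mem_cons_self _ _))]

section Relations

variable {B : Type*} [CommRing B]

/-- With `e(T) = ∑ e_i T^i`, the coefficient of `T^t` in `e(T)^r` vanishes whenever
`t + r > ∑ min(r, ξ_j)`. -/
def Relations (ξ : Multiset ℕ) (e : ℕ → B) : Prop :=
  ∀ r t, capSum ξ r < t + r → PowerSeries.coeff t (PowerSeries.mk e ^ r) = 0

theorem coe_window {e : ℕ → B} {n : ℕ} (h : ∀ i, n ≤ i → e i = 0) :
    (window e 0 n : PowerSeries B) = PowerSeries.mk e := by
  ext i
  rw [Polynomial.coeff_coe, window_coeff, PowerSeries.coeff_mk]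
  split_ifs with hi
  · rfl
  · exact (h i (by omega)).symm

/-! ### Changing the parts of the relations -/

namespace Relations

variable {ξ : Multiset ℕ} {e : ℕ → B}

/-- This is the case r = 1. It makes e(T) a polynomial, so degree arguments apply. -/
theorem eq_zero (h : Relations ξ e) {i : ℕ} (hi : Multiset.card ξ ≤ i) : e i = 0 := by
  have h1 := h 1 i (by have := capSum_le_mul_card ξ 1; omega)
  rwa [pow_one, PowerSeries.coeff_mk] at h1

theorem coeff_mk_pow (h : Relations ξ e) {n : ℕ} (hn : Multiset.card ξ ≤ n) (r t : ℕ) :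
    PowerSeries.coeff t (PowerSeries.mk e ^ r) = (window e 0 n ^ r).coeff t := by
  rw [← coe_window fun i hi => h.eq_zero (hn.trans hi), ← Polynomial.coe_pow, Polynomial.coeff_coe]

variable {η : Multiset ℕ} {b c : ℕ}

/-- Take r = b + 1 and the largest possible degree: the leading coefficient of e(T)^r is the r-th
power of the top generator, and the part b contributes only b < r to the bound. -/
theorem top_pow_eq_zero (h : Relations (b ::ₘ ξ) e) : e (Multiset.card ξ) ^ (b + 1) = 0 := by
  have h1 := h (b + 1) ((b + 1) * Multiset.card ξ) (by
    have := capSum_le_mul_card ξ (b + 1)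
    rw [capSum_cons]; omega)
  rw [h.coeff_mk_pow (n := Multiset.card ξ + 1) (by simp),
    Polynomial.coeff_pow_of_natDegree_le (window_natDegree_le _ _ _), window_coeff] at h1
  simpa using h1

/-- The annihilator of a power of the top generator contains the relations for a smaller `ξ`. -/
theorem top_pow_mul [Algebra ℂ B] (h : Relations (b ::ₘ c ::ₘ η) e) (hbc : b ≤ c)
    (hη : ∀ x ∈ η, c ≤ x) (r t : ℕ) (hrt : capSum ((c - b) ::ₘ η) r < t + r) :
    e (Multiset.card η + 1) ^ b * PowerSeries.coeff t (PowerSeries.mk e ^ r) = 0 := by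
  rw [h.coeff_mk_pow (n := Multiset.card η + 2) (by simp)]
  rw [capSum_cons] at hrt
  set N := Multiset.card η
  -- For r ≤ c - b every part of η is at least r, so t > r N. Since e_{N+1}^{b+1} = 0, the top term
  -- of e(T) may be dropped after multiplying by e_{N+1}^b, and the rest has degree at most N.
  rcases le_or_gt r (c - b) with hr | hr
  · have h0 : e (N + 1) ^ (b + 1) = 0 := by simpa using h.top_pow_eq_zero
    rw [capSum_eq_mul_card fun x hx => (hr.trans (Nat.sub_le c b)).trans (hη x hx),
      min_eq_left hr] at hrt
    rw [window_eq_add_right e (Nat.zero_le (N + 1))]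
    obtain ⟨q, hq⟩ := sub_dvd_pow_sub_pow
      (window e 0 (N + 1) + Polynomial.C (e (N + 1)) * Polynomial.X ^ (N + 1)) (window e 0 (N + 1)) r
    rw [add_sub_cancel_left, mul_assoc] at hq
    rw [sub_eq_iff_eq_add.1 hq, Polynomial.coeff_add, Polynomial.coeff_C_mul, mul_add, ← mul_assoc,
      ← pow_succ, h0, zero_mul, zero_add, Polynomial.coeff_eq_zero_of_natDegree_lt, mul_zero]
    refine (Polynomial.natDegree_pow_le_of_le r (window_natDegree_le e 0 N)).trans_lt ?_
    change r + r * N < t + r at hrt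
    omega
  · obtain ⟨η₁, η₂, hsplit, h₁, h₂⟩ : ∃ η₁ η₂, η = η₁ + η₂ ∧ (∀ x ∈ η₁, r ≤ x) ∧ ∀ x ∈ η₂, x ≤ r :=
      ⟨_, _, (Multiset.filter_add_not (r ≤ ·) η).symm, fun x hx => (Multiset.mem_filter.1 hx).2,
        fun x hx => (not_le.1 (Multiset.mem_filter.1 hx).2).le⟩
    -- For r > c - b, the concave function `capSum` is replaced by a line lying above it: parts in
    -- η₁ count as q, all other parts in full. Lowering this line by 2b turns c + b into c - b,
    -- which matches the target at r.
    refine top_pow_mul_coeff_window_zero_pow e (k := Multiset.card η₁) (c := η₂.sum + c + b)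
      (Multiset.card_le_card (hsplit ▸ Multiset.le_add_right _ _)) ?_ b r t ?_
    · intro q s hqs
      rw [← h.coeff_mk_pow (n := N + 2) (by simp [N])]
      refine h q s ?_
      rw [capSum_cons, capSum_cons, hsplit, capSum_add]
      have := capSum_le_mul_card η₁ q
      have := capSum_le_sum η₂ q
      omega
    · rw [hsplit, capSum_add, capSum_eq_mul_card h₁, capSum_eq_sum h₂] at hrt
      omega

/-- Adjoining the vanishing of a power of the top generator to the relations. -/
theorem of_top_pow_eq_zero (h : Relations ((b + 1) ::ₘ c ::ₘ η) e) (hη : ∀ x ∈ η, c ≤ x)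
    (h0 : e (Multiset.card η + 1) ^ (b + 1) = 0) : Relations (b ::ₘ (c + 1) ::ₘ η) e := by
  intro r t hrt
  by_cases hlt : capSum ((b + 1) ::ₘ c ::ₘ η) r < t + r
  · exact h r t hlt
  rw [capSum_cons, capSum_cons] at hrt hlt
  -- The two bounds differ only for b < r ≤ c, and there by 1.
  have hrc : r ≤ c := by omega
  rw [capSum_eq_mul_card fun x hx => hrc.trans (hη x hx)] at hrt hlt
  rw [h.coeff_mk_pow (n := Multiset.card η + 2) (by simp)]
  set N := Multiset.card η
  rw [window_eq_add_right e (Nat.zero_le (N + 1)), add_comm, add_pow, Polynomial.finsetSum_coeff]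
  refine Finset.sum_eq_zero fun j hj => ?_
  have hj' : j ≤ r := by have := Finset.mem_range.1 hj; omega
  rw [mul_pow, ← Polynomial.C_pow]
  -- Here j counts the factors e_{N+1} T^{N+1}. More than b of them give zero; with at most b the
  -- degree is at most r N + b < t.
  rcases le_or_gt (b + 1) j with hbj | hbj
  · rw [← Nat.add_sub_cancel' hbj, pow_add, h0]
    simp
  · refine Polynomial.coeff_eq_zero_of_natDegree_lt (lt_of_le_of_lt (b := (N + 1) * j + (r - j) * N)
      ?_ ?_)
    · refine (Polynomial.natDegree_mul_le).trans ?_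
      rw [Polynomial.natDegree_natCast, add_zero]
      refine (Polynomial.natDegree_mul_le).trans (add_le_add ?_ ?_)
      · rw [← pow_mul]; exact Polynomial.natDegree_C_mul_X_pow_le _ _
      · exact Polynomial.natDegree_pow_le_of_le _ (window_natDegree_le e 0 N)
    · obtain ⟨q, rfl⟩ := Nat.exists_eq_add_of_le hj'
      rw [Nat.add_sub_cancel_left]
      have : min (j + q) b = b := by omega
      have : min (j + q) (c + 1) = j + q := by omega
      nlinarith

/-- A single part is treated separately, since there is no second part to raise. Then e(T) is the
constant e_0. -/
theorem coeff_mk_pow_singleton (h : Relations {b} e) (r t : ℕ) :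
    PowerSeries.coeff t (PowerSeries.mk e ^ r) = if t = 0 then e 0 ^ r else 0 := by
  have h1 : PowerSeries.mk e = PowerSeries.C (e 0) := by
    ext i
    rw [PowerSeries.coeff_mk, PowerSeries.coeff_C]
    split_ifs with hi
    · rw [hi]
    · exact h.eq_zero (by simp; omega)
  rw [h1, ← map_pow, PowerSeries.coeff_C]

theorem top_pow_mul_singleton (h : Relations {b} e) (r t : ℕ) (hrt : 0 < t + r) :
    e 0 ^ b * PowerSeries.coeff t (PowerSeries.mk e ^ r) = 0 := by
  have h0 : e 0 ^ (b + 1) = 0 := by simpa using top_pow_eq_zero (ξ := 0) h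
  rw [h.coeff_mk_pow_singleton]
  split_ifs with ht
  · rw [← pow_add, show b + r = b + 1 + (r - 1) by omega, pow_add, h0, zero_mul]
  · rw [mul_zero]

theorem singleton_of_pow_eq_zero (h : Relations {b + 1} e) (h0 : e 0 ^ (b + 1) = 0) :
    Relations {b} e := by
  intro r t hrt
  rw [← Multiset.cons_zero, capSum_cons, capSum_zero] at hrt
  rw [h.coeff_mk_pow_singleton]
  split_ifs with ht
  · rw [show r = b + 1 + (r - (b + 1)) by omega, pow_add, h0, zero_mul]
  · rfl

end Relations

/-! ### The dimension bound -/

open MvPolynomial in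
/-- The ideal generated by the relations attached to `ξ` in infinitely many variables. -/
def relIdeal (ξ : Multiset ℕ) : Ideal (MvPolynomial ℕ ℂ) :=
  Ideal.span {p | ∃ r t, capSum ξ r < t + r ∧
    p = PowerSeries.coeff t (PowerSeries.mk (X : ℕ → MvPolynomial ℕ ℂ) ^ r)}

theorem map_coeff_mk_X_pow {B : Type*} [CommRing B] (φ : MvPolynomial ℕ ℂ →+* B) (r t : ℕ) :
    φ (PowerSeries.coeff t (PowerSeries.mk (MvPolynomial.X : ℕ → MvPolynomial ℕ ℂ) ^ r)) =
      PowerSeries.coeff t (PowerSeries.mk (fun i => φ (MvPolynomial.X i)) ^ r) := by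
  rw [← PowerSeries.coeff_map, map_pow]
  congr 2

theorem relIdeal_le_ker_iff {B : Type*} [CommRing B] (φ : MvPolynomial ℕ ℂ →+* B)
    (ξ : Multiset ℕ) :
    relIdeal ξ ≤ RingHom.ker φ ↔ Relations ξ fun i => φ (MvPolynomial.X i) := by
  rw [relIdeal, Ideal.span_le]
  constructor
  · intro h r t hrt
    rw [← map_coeff_mk_X_pow]
    exact h ⟨r, t, hrt, rfl⟩
  · rintro h _ ⟨r, t, hrt, rfl⟩
    rw [SetLike.mem_coe, RingHom.mem_ker, map_coeff_mk_X_pow]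
    exact h r t hrt

theorem relIdeal_le_iff (I : Ideal (MvPolynomial ℕ ℂ)) (ξ : Multiset ℕ) :
    relIdeal ξ ≤ I ↔ Relations ξ fun i => Ideal.Quotient.mk I (MvPolynomial.X i) := by
  rw [← relIdeal_le_ker_iff, Ideal.mk_ker]

/-- If `I ⊔ (g)` contains `I₁` and `(I : g)` contains `I₂`, then `R / I` is at most as large as
`R / I₁` and `R / I₂` together. -/
theorem rank_quotient_le_add {R : Type u} [CommRing R] [Algebra ℂ R] {I I₁ I₂ : Ideal R} (g : R)
    (h₁ : I₁ ≤ I ⊔ Ideal.span {g}) (h₂ : ∀ x ∈ I₂, g * x ∈ I) :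
    Module.rank ℂ (R ⧸ I) ≤ Module.rank ℂ (R ⧸ I₁) + Module.rank ℂ (R ⧸ I₂) := by
  let m : (R ⧸ I₂) →ₗ[ℂ] (R ⧸ I) :=
    (Submodule.mapQ I₂ I (LinearMap.mulLeft R g) h₂).restrictScalars ℂ
  let q : R →ₗ[ℂ] (R ⧸ I) ⧸ LinearMap.range m :=
    (LinearMap.range m).mkQ ∘ₗ (Ideal.Quotient.mkₐ ℂ I).toLinearMap
  have hq : I₁.restrictScalars ℂ ≤ LinearMap.ker q := by
    intro x hx
    obtain ⟨y, hy, w, hw, rfl⟩ := Submodule.mem_sup.1 (h₁ hx)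
    obtain ⟨v, rfl⟩ := Ideal.mem_span_singleton'.1 hw
    have hy0 : Ideal.Quotient.mk I y = 0 := Ideal.Quotient.eq_zero_iff_mem.2 hy
    rw [LinearMap.mem_ker]
    change (LinearMap.range m).mkQ (Ideal.Quotient.mk I (y + v * g)) = 0
    rw [map_add, hy0, zero_add]
    refine (Submodule.Quotient.mk_eq_zero _).2 ⟨Ideal.Quotient.mk I₂ v, ?_⟩
    change Ideal.Quotient.mk I (g * v) = _
    rw [mul_comm]
  have hs : Function.Surjective ((I₁.restrictScalars ℂ).liftQ q hq) := by
    rw [← LinearMap.range_eq_top, Submodule.range_liftQ, LinearMap.range_eq_top]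
    exact (Submodule.mkQ_surjective _).comp Ideal.Quotient.mk_surjective
  rw [← Submodule.rank_quotient_add_rank (LinearMap.range m)]
  exact add_le_add (LinearMap.rank_le_of_surjective _ hs) (rank_range_le m)

theorem relIdeal_zero_cons (ξ : Multiset ℕ) : relIdeal (0 ::ₘ ξ) = relIdeal ξ := by
  simp [relIdeal]

/-- The hypotheses range over all ideals so that they can be read in two quotients: the first modulo
`relIdeal ξ` plus the power of the generator, the second modulo `relIdeal ξ` itself. -/
theorem rank_quotient_relIdeal_le_step {ξ ξ₁ ξ₂ : Multiset ℕ} (k b : ℕ)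
    (h₁ : ∀ (I : Ideal (MvPolynomial ℕ ℂ)), Relations ξ (fun i => Ideal.Quotient.mk I (MvPolynomial.X i)) →
      (Ideal.Quotient.mk I (MvPolynomial.X k)) ^ b = 0 →
      Relations ξ₁ fun i => Ideal.Quotient.mk I (MvPolynomial.X i))
    (h₂ : ∀ (I : Ideal (MvPolynomial ℕ ℂ)), Relations ξ (fun i => Ideal.Quotient.mk I (MvPolynomial.X i)) →
      ∀ r t, capSum ξ₂ r < t + r → (Ideal.Quotient.mk I (MvPolynomial.X k)) ^ b *
        PowerSeries.coeff t (PowerSeries.mk (fun i => Ideal.Quotient.mk I (MvPolynomial.X i)) ^ r) = 0) :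
    Module.rank ℂ (MvPolynomial ℕ ℂ ⧸ relIdeal ξ) ≤
      Module.rank ℂ (MvPolynomial ℕ ℂ ⧸ relIdeal ξ₁) +
        Module.rank ℂ (MvPolynomial ℕ ℂ ⧸ relIdeal ξ₂) := by
  refine rank_quotient_le_add (MvPolynomial.X k ^ b) ?_ ?_
  · rw [relIdeal_le_iff]
    refine h₁ _ ((relIdeal_le_iff _ _).1 le_sup_left) ?_
    rw [← map_pow, Ideal.Quotient.eq_zero_iff_mem]
    exact Ideal.mem_sup_right (Ideal.mem_span_singleton_self _)
  · intro x hx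
    have hle : relIdeal ξ₂ ≤ (relIdeal ξ).colon {MvPolynomial.X k ^ b} := by
      rw [relIdeal, Ideal.span_le]
      rintro _ ⟨r, t, hrt, rfl⟩
      rw [SetLike.mem_coe, Submodule.mem_colon_singleton, smul_eq_mul, mul_comm,
        ← Ideal.Quotient.eq_zero_iff_mem, map_mul, map_pow, map_coeff_mk_X_pow]
      exact h₂ _ ((relIdeal_le_iff _ _).1 le_rfl) r t hrt
    have := Submodule.mem_colon_singleton.1 (hle hx)
    rwa [smul_eq_mul, mul_comm] at this

theorem exists_min_cons {ξ : Multiset ℕ} (h : ξ ≠ 0) :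
    ∃ (b : ℕ) (η : Multiset ℕ), ξ = b ::ₘ η ∧ ∀ x ∈ η, b ≤ x := by
  obtain ⟨b, hb, hmin⟩ := Finset.exists_min_image ξ.toFinset id
    (by simpa [Finset.nonempty_iff_ne_empty] using h)
  obtain ⟨η, rfl⟩ := Multiset.exists_cons_of_mem (Multiset.mem_toFinset.1 hb)
  exact ⟨b, η, rfl, fun x hx => hmin x (by simp [hx])⟩

/-- Outer induction on the number of parts, inner induction on the smallest part. The quotient by
the power of the top generator lowers the smallest part; the annihilator has one part fewer; a part
equal to 0 can be deleted. -/
theorem rank_quotient_relIdeal_le (ξ : Multiset ℕ) :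
    Module.rank ℂ (MvPolynomial ℕ ℂ ⧸ relIdeal ξ) ≤ ((ξ.map (· + 1)).prod : ℕ) := by
  induction hn : Multiset.card ξ generalizing ξ with
  | zero =>
    rw [Multiset.card_eq_zero] at hn
    subst hn
    have hX : ∀ i, (MvPolynomial.X i : MvPolynomial ℕ ℂ) ∈ relIdeal 0 := fun i => by
      rw [← Ideal.Quotient.eq_zero_iff_mem]
      exact ((relIdeal_le_iff _ _).1 le_rfl).eq_zero (Nat.zero_le i)
    have hs : Function.Surjective (Algebra.linearMap ℂ (MvPolynomial ℕ ℂ ⧸ relIdeal 0)) := by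
      intro x
      obtain ⟨p, rfl⟩ := Ideal.Quotient.mk_surjective x
      induction p using MvPolynomial.induction_on with
      | C a => exact ⟨a, rfl⟩
      | add p q hp hq =>
        obtain ⟨a, ha⟩ := hp
        obtain ⟨b, hb⟩ := hq
        exact ⟨a + b, by rw [map_add, ha, hb, map_add]⟩
      | mul_X p i _ =>
        exact ⟨0, by rw [map_zero, map_mul, Ideal.Quotient.eq_zero_iff_mem.2 (hX i), mul_zero]⟩
    simpa using LinearMap.rank_le_of_surjective _ hs
  | succ n ih =>
    have main : ∀ b ξ', Multiset.card ξ' = n → (∀ x ∈ ξ', b ≤ x) →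
        Module.rank ℂ (MvPolynomial ℕ ℂ ⧸ relIdeal (b ::ₘ ξ')) ≤
          (((b ::ₘ ξ').map (· + 1)).prod : ℕ) := by
      intro b
      induction b with
      | zero =>
        intro ξ' hξ' _
        rw [relIdeal_zero_cons]
        simpa using ih ξ' hξ'
      | succ b ihb =>
        intro ξ' hξ' hb
        by_cases h0 : ξ' = 0
        · subst h0
          refine (rank_quotient_relIdeal_le_step (ξ₁ := b ::ₘ 0) (ξ₂ := 0) 0 (b + 1)
            (fun I h h0 => h.singleton_of_pow_eq_zero h0)
            (fun I h r t hrt => h.top_pow_mul_singleton r t hrt)).trans ?_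
          refine (add_le_add (ihb 0 hξ' (by simp)) (ih 0 hξ')).trans ?_
          rw [← Nat.cast_add]
          simp
        · obtain ⟨c, η, rfl, hη⟩ := exists_min_cons h0
          have hbc : b + 1 ≤ c := hb c (Multiset.mem_cons_self _ _)
          rw [Multiset.card_cons] at hξ'
          refine (rank_quotient_relIdeal_le_step (ξ₁ := b ::ₘ (c + 1) ::ₘ η)
            (ξ₂ := (c - (b + 1)) ::ₘ η) (Multiset.card η + 1) (b + 1)
            (fun I h h0 => h.of_top_pow_eq_zero hη h0)
            (fun I h r t hrt => h.top_pow_mul hbc hη r t hrt)).trans ?_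
          refine (add_le_add (ihb ((c + 1) ::ₘ η) (by simpa using hξ') ?_)
            (ih ((c - (b + 1)) ::ₘ η) (by simpa using hξ'))).trans ?_
          · intro x hx
            rcases Multiset.mem_cons.1 hx with rfl | hx
            · omega
            · have := hη x hx; omega
          rw [← Nat.cast_add, Nat.cast_le]
          -- The count closes by (b + 2)(c + 1) = (b + 1)(c + 2) + (c - b), with d = c - b - 1.
          obtain ⟨d, rfl⟩ := Nat.exists_eq_add_of_le hbc
          simp only [Multiset.map_cons, Multiset.prod_cons, Nat.add_sub_cancel_left]
          refine le_of_eq ?_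
          ring
    have h0 : ξ ≠ 0 := by rintro rfl; simp at hn
    obtain ⟨b, η, rfl, hη⟩ := exists_min_cons h0
    exact main b η (by simpa using hn) hη

end Relations

/-! ### Power sums of nilpotent elements -/

section PowerSums

variable {A ι : Type*} [CommRing A] [Fintype ι]

/-- `∏ (1 - z_i T)^{b_i}`. -/
def denom (z : ι → A) (b : ι → ℕ) : Polynomial A :=
  ∏ i, (1 - Polynomial.C (z i) * Polynomial.X) ^ b i

/-- `1 / (1 - z T)`. -/
def geom (z : A) : PowerSeries A := PowerSeries.mk fun k => z ^ k

theorem geom_mul (z : A) :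
    geom z * ((1 - Polynomial.C z * Polynomial.X : Polynomial A) : PowerSeries A) = 1 := by
  rw [Polynomial.coe_sub, Polynomial.coe_mul, Polynomial.coe_C, Polynomial.coe_X, Polynomial.coe_one,
    mul_sub, mul_one]
  ext k
  rw [map_sub, mul_left_comm, PowerSeries.coeff_C_mul]
  rcases k with _ | k
  · simp [geom]
  · rw [PowerSeries.coeff_succ_mul_X]
    simp [geom, PowerSeries.coeff_one, pow_succ']

theorem coe_denom (z : ι → A) (b : ι → ℕ) : (denom z b : PowerSeries A) =
    ∏ i, ((1 - Polynomial.C (z i) * Polynomial.X : Polynomial A) : PowerSeries A) ^ b i := by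
  rw [denom, ← Polynomial.coeToPowerSeries.ringHom_apply, map_prod]
  simp

theorem mk_sum_pow_mul (z y : ι → A) :
    (PowerSeries.mk fun k => ∑ i, z i ^ k * y i) = ∑ i, PowerSeries.C (y i) * geom (z i) := by
  ext k
  rw [PowerSeries.coeff_mk, map_sum]
  exact Finset.sum_congr rfl fun i _ => by
    rw [PowerSeries.coeff_C_mul, geom, PowerSeries.coeff_mk, mul_comm]

theorem natDegree_denom_le (z : ι → A) (b : ι → ℕ) : (denom z b).natDegree ≤ ∑ i, b i := by
  refine (Polynomial.natDegree_prod_le _ _).trans (Finset.sum_le_sum fun i _ => ?_)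
  refine (Polynomial.natDegree_pow_le_of_le (m := 1) (b i) ?_).trans (by simp)
  refine (Polynomial.natDegree_sub_le _ _).trans (max_le (by simp) ?_)
  simpa using Polynomial.natDegree_C_mul_X_pow_le (z i) 1

/-- Powers of the generating function of weighted power sums of nilpotent elements are rational
functions with controlled denominator and degree. -/
theorem coeff_pow_mul_denom_eq_zero (z y : ι → A) (b : ι → ℕ) (hy : ∀ i, y i ^ (b i + 1) = 0)
    {r t : ℕ} (hrt : ∑ i, min r (b i) < t + r) :
    PowerSeries.coeff t ((PowerSeries.mk fun k => ∑ i, z i ^ k * y i) ^ r *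
      (denom z fun i => min r (b i) : PowerSeries A)) = 0 := by
  classical
  rw [mk_sum_pow_mul, Finset.sum_pow_eq_sum_piAntidiag, Finset.sum_mul, map_sum]
  refine Finset.sum_eq_zero fun m hm => ?_
  obtain ⟨hm, -⟩ := Finset.mem_piAntidiag.1 hm
  rw [mul_assoc, ← map_natCast (PowerSeries.C (R := A)), PowerSeries.coeff_C_mul]
  -- A multinomial term with some m_i > b_i contains a vanishing power of y_i. Otherwise m_i ≤
  -- min(r, b_i), and the denominator clears every pole.
  by_cases hmb : ∀ i, m i ≤ b i
  · have hmr : ∀ i, m i ≤ min r (b i) := fun i => le_min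
      (hm ▸ Finset.single_le_sum (f := m) (fun _ _ => Nat.zero_le _) (Finset.mem_univ i)) (hmb i)
    have h1 : (∏ i, (PowerSeries.C (y i) * geom (z i)) ^ m i) *
        (denom z fun i => min r (b i) : PowerSeries A) =
        PowerSeries.C (∏ i, y i ^ m i) * (denom z fun i => min r (b i) - m i : PowerSeries A) := by
      rw [coe_denom, coe_denom, map_prod, ← Finset.prod_mul_distrib, ← Finset.prod_mul_distrib]
      refine Finset.prod_congr rfl fun i _ => ?_
      have hg := geom_mul (z i)
      set D : PowerSeries A := ((1 - Polynomial.C (z i) * Polynomial.X : Polynomial A) : PowerSeries A)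
      obtain ⟨k, hk⟩ := Nat.exists_eq_add_of_le (hmr i)
      rw [hk, Nat.add_sub_cancel_left, pow_add, map_pow]
      calc (PowerSeries.C (y i) * geom (z i)) ^ m i * (D ^ m i * D ^ k) =
          PowerSeries.C (y i) ^ m i * (geom (z i) * D) ^ m i * D ^ k := by ring
        _ = _ := by rw [hg, one_pow, mul_one]
    rw [h1, PowerSeries.coeff_C_mul, Polynomial.coeff_coe, Polynomial.coeff_eq_zero_of_natDegree_lt,
      mul_zero, mul_zero]
    -- The remaining polynomial has degree at most ∑ (min(r, b_i) - m_i) = ∑ min(r, b_i) - r.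
    refine (natDegree_denom_le _ _).trans_lt ?_
    have h2 : ∑ i, (min r (b i) - m i) + ∑ i, m i = ∑ i, min r (b i) := by
      rw [← Finset.sum_add_distrib]
      exact Finset.sum_congr rfl fun i _ => Nat.sub_add_cancel (hmr i)
    have hm' : ∑ i, m i = r := hm
    omega
  · push Not at hmb
    obtain ⟨i, hi⟩ := hmb
    rw [Finset.prod_eq_zero (Finset.mem_univ i), zero_mul, map_zero, mul_zero]
    rw [mul_pow, ← map_pow, ← Nat.add_sub_cancel' (Nat.succ_le_of_lt hi), pow_add, Nat.succ_eq_add_one,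
      hy, zero_mul, map_zero, zero_mul]

theorem coeff_zero_denom (z : ι → A) (b : ι → ℕ) : (denom z b).coeff 0 = 1 := by
  simp [denom, Polynomial.coeff_zero_eq_eval_zero, Polynomial.eval_prod]

end PowerSums

/-! ### Coefficientwise limits of polynomials and of power series over them -/

section Limits

open Filter Topology

variable {X σ : Type*} {l : Filter X}

/-- Coefficientwise convergence of polynomials. -/
def CoeffTendsto (q : X → MvPolynomial σ ℂ) (l : Filter X) (p : MvPolynomial σ ℂ) : Prop :=
  ∀ m, Tendsto (fun x => (q x).coeff m) l (𝓝 (p.coeff m))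

theorem CoeffTendsto.const (p : MvPolynomial σ ℂ) : CoeffTendsto (fun _ : X => p) l p :=
  fun _ => tendsto_const_nhds

theorem CoeffTendsto.congr_left {q q' : X → MvPolynomial σ ℂ} {p : MvPolynomial σ ℂ}
    (h : CoeffTendsto q l p) (hq : ∀ x, q' x = q x) : CoeffTendsto q' l p := by
  rwa [funext hq]

theorem CoeffTendsto.add {q q' : X → MvPolynomial σ ℂ} {p p' : MvPolynomial σ ℂ}
    (h : CoeffTendsto q l p) (h' : CoeffTendsto q' l p') :
    CoeffTendsto (fun x => q x + q' x) l (p + p') := fun m => by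
  simpa only [MvPolynomial.coeff_add] using (h m).add (h' m)

theorem CoeffTendsto.mul {q q' : X → MvPolynomial σ ℂ} {p p' : MvPolynomial σ ℂ}
    (h : CoeffTendsto q l p) (h' : CoeffTendsto q' l p') :
    CoeffTendsto (fun x => q x * q' x) l (p * p') := fun m => by
  classical
  simp only [MvPolynomial.coeff_mul]
  exact tendsto_finsetSum _ fun i _ => (h _).mul (h' _)

theorem CoeffTendsto.sum {ι : Type*} {s : Finset ι} {q : ι → X → MvPolynomial σ ℂ}
    {p : ι → MvPolynomial σ ℂ} (h : ∀ i ∈ s, CoeffTendsto (q i) l (p i)) :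
    CoeffTendsto (fun x => ∑ i ∈ s, q i x) l (∑ i ∈ s, p i) := fun m => by
  simp only [MvPolynomial.coeff_sum]
  exact tendsto_finsetSum _ fun i hi => h i hi m

theorem CoeffTendsto.C {c : X → ℂ} {c₀ : ℂ} (h : Tendsto c l (𝓝 c₀)) :
    CoeffTendsto (fun x => (MvPolynomial.C (c x) : MvPolynomial σ ℂ)) l (MvPolynomial.C c₀) :=
  fun m => by
  classical
  simp only [MvPolynomial.coeff_C]
  split_ifs
  · exact h
  · exact tendsto_const_nhds

/-- Coefficientwise convergence of power series over a polynomial ring. -/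
def SeriesTendsto (q : X → PowerSeries (MvPolynomial σ ℂ)) (l : Filter X)
    (p : PowerSeries (MvPolynomial σ ℂ)) : Prop :=
  ∀ t, CoeffTendsto (fun x => PowerSeries.coeff t (q x)) l (PowerSeries.coeff t p)

theorem SeriesTendsto.const (p : PowerSeries (MvPolynomial σ ℂ)) :
    SeriesTendsto (fun _ : X => p) l p :=
  fun _ => CoeffTendsto.const _

theorem SeriesTendsto.mul {q q' : X → PowerSeries (MvPolynomial σ ℂ)}
    {p p' : PowerSeries (MvPolynomial σ ℂ)} (h : SeriesTendsto q l p) (h' : SeriesTendsto q' l p') :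
    SeriesTendsto (fun x => q x * q' x) l (p * p') := fun t => by
  simp only [PowerSeries.coeff_mul]
  exact CoeffTendsto.sum fun i _ => (h _).mul (h' _)

theorem SeriesTendsto.pow {q : X → PowerSeries (MvPolynomial σ ℂ)}
    {p : PowerSeries (MvPolynomial σ ℂ)} (h : SeriesTendsto q l p) (r : ℕ) :
    SeriesTendsto (fun x => q x ^ r) l (p ^ r) := by
  induction r with
  | zero => simpa using SeriesTendsto.const 1
  | succ r ih => simpa only [pow_succ] using ih.mul h

theorem SeriesTendsto.prod_one {ι : Type*} (s : Finset ι)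
    {q : ι → X → PowerSeries (MvPolynomial σ ℂ)} (h : ∀ i ∈ s, SeriesTendsto (q i) l 1) :
    SeriesTendsto (fun x => ∏ i ∈ s, q i x) l 1 := by
  classical
  induction s using Finset.induction_on with
  | empty => simpa using SeriesTendsto.const 1
  | insert i s hi ih =>
    simp only [Finset.prod_insert hi]
    simpa using (h i (Finset.mem_insert_self _ _)).mul
      (ih fun j hj => h j (Finset.mem_insert_of_mem hj))

theorem SeriesTendsto.trunc {q : X → PowerSeries (MvPolynomial σ ℂ)}
    {p : PowerSeries (MvPolynomial σ ℂ)} (h : SeriesTendsto q l p) (n : ℕ) :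
    SeriesTendsto (fun x => (PowerSeries.trunc n (q x) : PowerSeries (MvPolynomial σ ℂ))) l
      (PowerSeries.trunc n p) := fun t => by
  simp only [Polynomial.coeff_coe, PowerSeries.coeff_trunc]
  split_ifs
  · exact h t
  · exact CoeffTendsto.const 0

theorem SeriesTendsto.geom {c : X → ℂ} (h : Tendsto c l (𝓝 0)) :
    SeriesTendsto (fun x => geom (MvPolynomial.C (c x) : MvPolynomial σ ℂ)) l 1 := fun t => by
  simp only [Fusion.geom, PowerSeries.coeff_mk, PowerSeries.coeff_one, ← map_pow]
  have h1 := CoeffTendsto.C (σ := σ) (h.pow t)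
  split_ifs with ht
  · simpa [ht] using h1
  · simpa [ht] using h1

theorem SeriesTendsto.denom {ι : Type*} [Fintype ι] {z : X → ι → ℂ} (h : Tendsto z l (𝓝 0))
    (b : ι → ℕ) : SeriesTendsto (fun x => (denom (fun i => (MvPolynomial.C (z x i) :
      MvPolynomial σ ℂ)) b : PowerSeries (MvPolynomial σ ℂ))) l 1 := by
  simp only [coe_denom]
  refine SeriesTendsto.prod_one _ fun i _ => ?_
  have h2 := SeriesTendsto.pow (l := l) (q := fun x => ((1 - Polynomial.C (MvPolynomial.C (z x i)) *
    Polynomial.X : Polynomial (MvPolynomial σ ℂ)) : PowerSeries (MvPolynomial σ ℂ))) (p := 1) ?_ (b i)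
  · rwa [one_pow] at h2
  intro t
  have hi : Tendsto (fun x => z x i) l (𝓝 0) := (tendsto_pi_nhds.1 h) i
  have h1 := (CoeffTendsto.const (X := X) (l := l) (if t = 0 then (1 : MvPolynomial σ ℂ) else 0)).add
    ((CoeffTendsto.C (σ := σ) hi.neg).mul (CoeffTendsto.const (Polynomial.X.coeff t)))
  simp only [neg_zero, map_zero, zero_mul, add_zero] at h1
  rw [PowerSeries.coeff_one]
  refine h1.congr_left fun x => ?_
  rw [Polynomial.coeff_coe, Polynomial.coeff_sub, Polynomial.coeff_C_mul, Polynomial.coeff_one,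
    map_neg, neg_mul, sub_eq_add_neg]

end Limits

/-! ### The limit of the ideals `I(Z)` -/

section LimitIdeal

variable {n : ℕ}

open Filter Topology

/-- The parts `ξ_i = a_i - 1`. -/
def parts (a : Fin n → ℕ) : Multiset ℕ := Finset.univ.val.map fun i => a i - 1

theorem capSum_parts (a : Fin n → ℕ) (r : ℕ) : capSum (parts a) r = ∑ i, min r (a i - 1) := by
  rw [capSum, parts, Multiset.map_map]; rfl

theorem card_parts (a : Fin n → ℕ) : Multiset.card (parts a) = n := by simp [parts]

theorem prod_parts (a : Fin n → ℕ) (ha : ∀ i, 0 < a i) :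
    ((parts a).map (· + 1)).prod = ∏ i, a i := by
  rw [parts, Multiset.map_map]
  exact Finset.prod_congr rfl fun i _ => Nat.sub_add_cancel (ha i)

/-- The homomorphism that kills the variables `e_i` with `i ≥ n`. -/
def truncVars (n : ℕ) : MvPolynomial ℕ ℂ →ₐ[ℂ] MvPolynomial (Fin n) ℂ :=
  MvPolynomial.aeval fun i => if h : i < n then MvPolynomial.X ⟨i, h⟩ else 0

theorem truncVars_X (i : ℕ) : truncVars n (MvPolynomial.X i) =
    if h : i < n then MvPolynomial.X ⟨i, h⟩ else 0 :=
  MvPolynomial.aeval_X _ _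

theorem truncVars_surjective (n : ℕ) : Function.Surjective (truncVars n) := by
  intro p
  refine ⟨MvPolynomial.rename Fin.val p, ?_⟩
  rw [truncVars, MvPolynomial.aeval_rename]
  convert MvPolynomial.aeval_X_left_apply (R := ℂ) p using 3
  ext i
  simp

/-- The explicit form of the limit ideal. -/
def limitIdeal (a : Fin n → ℕ) : Ideal (MvPolynomial (Fin n) ℂ) :=
  (relIdeal (parts a)).map (truncVars n)

/-- The generating series `∑ e_i T^i` over `i < n`. -/
def genSeries (n : ℕ) : PowerSeries (MvPolynomial (Fin n) ℂ) :=
  PowerSeries.mk fun i => truncVars n (MvPolynomial.X i)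

theorem limitIdeal_eq_span (a : Fin n → ℕ) : limitIdeal a =
    Ideal.span {p | ∃ r t, capSum (parts a) r < t + r ∧
      p = PowerSeries.coeff t (genSeries n ^ r)} := by
  rw [limitIdeal, relIdeal, Ideal.map_span]
  congr 1
  ext p
  constructor
  · rintro ⟨_, ⟨r, t, hrt, rfl⟩, rfl⟩
    exact ⟨r, t, hrt, map_coeff_mk_X_pow (truncVars n).toRingHom r t⟩
  · rintro ⟨r, t, hrt, rfl⟩
    exact ⟨_, ⟨r, t, hrt, rfl⟩, map_coeff_mk_X_pow (truncVars n).toRingHom r t⟩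

/-- A deformation of `genSeries n`, which the homomorphism defining `I(Z)` maps to
`∑ y_i / (1 - z_i T)`. -/
def deformedSeries (z : Fin n → ℂ) : PowerSeries (MvPolynomial (Fin n) ℂ) :=
  (PowerSeries.trunc n (genSeries n *
    (↑(denom (fun i => (MvPolynomial.C (z i) : MvPolynomial (Fin n) ℂ)) fun _ => 1) :
      PowerSeries (MvPolynomial (Fin n) ℂ))) : PowerSeries (MvPolynomial (Fin n) ℂ)) *
  ∏ i, geom (MvPolynomial.C (z i))

/-- All factors 1 - z_i T and their inverses tend to 1, and `genSeries n` has no terms of degree n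
or more, so the truncation is harmless in the limit. -/
theorem deformedSeries_tendsto {l : Filter (Fin n → ℂ)} (hl : l ≤ 𝓝 0) :
    SeriesTendsto deformedSeries l (genSeries n) := by
  have hz : Tendsto (fun z : Fin n → ℂ => z) l (𝓝 0) := hl
  have h1 := (((SeriesTendsto.const (genSeries n)).mul
    (SeriesTendsto.denom (σ := Fin n) hz fun _ => 1)).trunc n).mul
    (SeriesTendsto.prod_one Finset.univ fun i _ =>
      SeriesTendsto.geom (σ := Fin n) ((tendsto_pi_nhds.1 hz) i))
  have h2 : (PowerSeries.trunc n (genSeries n * 1) : PowerSeries (MvPolynomial (Fin n) ℂ)) * 1 =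
      genSeries n := by
    ext1 t
    rw [mul_one, mul_one, Polynomial.coeff_coe, PowerSeries.coeff_trunc, genSeries,
      PowerSeries.coeff_mk, truncVars_X]
    split_ifs <;> rfl
  rw [h2] at h1
  exact h1

/-- Over the common denominator ∏ (1 - z_i T) the series ∑ y_i / (1 - z_i T) has a numerator of
degree below n. That numerator is therefore determined by the first n coefficients, the images of
e_0, …, e_{n-1}. -/
theorem map_deformedSeries {A : Type*} [CommRing A] [Algebra ℂ A] (z : Fin n → ℂ) (y : Fin n → A)
    (b : Fin n → ℕ) (hy : ∀ i, y i ^ (b i + 1) = 0) :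
    PowerSeries.map (MvPolynomial.aeval (R := ℂ) fun k : Fin n => ∑ i, z i ^ (k : ℕ) • y i :
        MvPolynomial (Fin n) ℂ →ₐ[ℂ] A) (deformedSeries z) =
      PowerSeries.mk fun k => ∑ i, z i ^ k • y i := by
  set α : MvPolynomial (Fin n) ℂ →ₐ[ℂ] A :=
    MvPolynomial.aeval (R := ℂ) fun k : Fin n => ∑ i, z i ^ (k : ℕ) • y i
  set E : PowerSeries A := PowerSeries.mk fun k => ∑ i, z i ^ k • y i with hE
  have hE' : E = PowerSeries.mk fun k => ∑ i, algebraMap ℂ A (z i) ^ k * y i := by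
    simp_rw [hE, Algebra.smul_def, map_pow]
  set Q : PowerSeries A := ↑(denom (fun i => algebraMap ℂ A (z i)) fun _ => 1)
  have hαC : ∀ c : ℂ, (α : MvPolynomial (Fin n) ℂ →+* A) (MvPolynomial.C c) = algebraMap ℂ A c :=
    fun c => MvPolynomial.aeval_C _ _
  have hgeom : ∀ i, PowerSeries.map (α : MvPolynomial (Fin n) ℂ →+* A)
      (geom (MvPolynomial.C (z i))) = geom (algebraMap ℂ A (z i)) := fun i => by
    ext k
    rw [PowerSeries.coeff_map, geom, geom, PowerSeries.coeff_mk, PowerSeries.coeff_mk, map_pow, hαC]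
  have hQ : PowerSeries.map (α : MvPolynomial (Fin n) ℂ →+* A)
      (↑(denom (fun i => (MvPolynomial.C (z i) : MvPolynomial (Fin n) ℂ)) fun _ => 1) :
        PowerSeries (MvPolynomial (Fin n) ℂ)) =
      Q := by
    rw [← Polynomial.polynomial_map_coe, denom, Polynomial.map_prod]
    simp only [Polynomial.map_pow, Polynomial.map_sub, Polynomial.map_mul, Polynomial.map_C,
      Polynomial.map_X, Polynomial.map_one, hαC]
    rfl
  have hinv : Q * ∏ i, geom (algebraMap ℂ A (z i)) = 1 := by
    simp only [Q]
    rw [mul_comm, coe_denom, ← Finset.prod_mul_distrib]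
    exact Finset.prod_eq_one fun i _ => by rw [pow_one, geom_mul]
  have htail : ∀ t, n ≤ t → PowerSeries.coeff t (E * Q) = 0 := by
    intro t ht
    -- Using b_i + 1 in place of b_i makes min(1, b_i + 1) = 1 for every i, so the denominator is
    -- exactly Q even when b_i = 0.
    have h1 := coeff_pow_mul_denom_eq_zero (fun i => algebraMap ℂ A (z i)) y (fun i => b i + 1)
      (fun i => by rw [pow_succ, hy, zero_mul]) (r := 1) (t := t) (by simp; omega)
    rw [pow_one, ← hE'] at h1
    simpa using h1
  have hlow : ∀ t, t < n → PowerSeries.coeff t (PowerSeries.map (α : MvPolynomial (Fin n) ℂ →+* A)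
      (genSeries n)) = PowerSeries.coeff t E := by
    intro t ht
    rw [PowerSeries.coeff_map, genSeries, PowerSeries.coeff_mk, truncVars_X, dif_pos ht, hE,
      PowerSeries.coeff_mk]
    exact MvPolynomial.aeval_X _ _
  have hnum : PowerSeries.map (α : MvPolynomial (Fin n) ℂ →+* A) (PowerSeries.trunc n
      (genSeries n * (↑(denom (fun i => (MvPolynomial.C (z i) : MvPolynomial (Fin n) ℂ)) fun _ => 1) :
        PowerSeries (MvPolynomial (Fin n) ℂ))) : PowerSeries (MvPolynomial (Fin n) ℂ)) = E * Q := by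
    ext t
    rw [PowerSeries.coeff_map, Polynomial.coeff_coe, PowerSeries.coeff_trunc]
    split_ifs with ht
    · rw [← PowerSeries.coeff_map, map_mul, hQ, PowerSeries.coeff_mul, PowerSeries.coeff_mul]
      refine Finset.sum_congr rfl fun p hp => ?_
      have := Finset.HasAntidiagonal.mem_antidiagonal.1 hp
      rw [hlow _ (by omega)]
    · rw [map_zero, htail t (by omega)]
  change PowerSeries.map (α : MvPolynomial (Fin n) ℂ →+* A) (deformedSeries z) = E
  rw [deformedSeries, map_mul, hnum, map_prod]
  simp_rw [hgeom]
  rw [mul_assoc, hinv, mul_one]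

/-- The ideal of coefficientwise limits of elements of a family of ideals. -/
def idealOfLimits {X σ : Type*} (I : X → Ideal (MvPolynomial σ ℂ)) (l : Filter X) :
    Ideal (MvPolynomial σ ℂ) where
  carrier := {p | ∃ q : X → MvPolynomial σ ℂ, (∀ᶠ x in l, q x ∈ I x) ∧ CoeffTendsto q l p}
  add_mem' := by
    rintro p p' ⟨q, hq, h⟩ ⟨q', hq', h'⟩
    exact ⟨_, (hq.and hq').mono fun x hx => (I x).add_mem hx.1 hx.2, h.add h'⟩
  zero_mem' := ⟨fun _ => 0, Eventually.of_forall fun x => (I x).zero_mem, CoeffTendsto.const 0⟩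
  smul_mem' := by
    rintro c p ⟨q, hq, h⟩
    exact ⟨_, hq.mono fun x hx => (I x).mul_mem_left c hx, (CoeffTendsto.const c).mul h⟩

theorem truncAlg_X_pow (a : Fin n → ℕ) (i : Fin n) :
    (Ideal.Quotient.mk _ (MvPolynomial.X i) : TruncAlg a) ^ a i = 0 := by
  rw [← map_pow, Ideal.Quotient.eq_zero_iff_mem]
  exact Ideal.subset_span ⟨i, rfl⟩

/-- Each generator is lifted to the coefficient of T^t in the r-th power of the deformed series
times its denominator. This lies in I(Z) by rationality, and the denominator tends to 1. -/
theorem limitIdeal_le_idealOfLimits (a : Fin n → ℕ) (ha : ∀ i, 0 < a i)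
    {l : Filter (Fin n → ℂ)} (hl : l ≤ 𝓝 0) : limitIdeal a ≤ idealOfLimits (idealI a) l := by
  rw [limitIdeal_eq_span, Ideal.span_le]
  rintro _ ⟨r, t, hrt, rfl⟩
  refine ⟨fun z => PowerSeries.coeff t (deformedSeries z ^ r *
    (↑(denom (fun i => (MvPolynomial.C (z i) : MvPolynomial (Fin n) ℂ)) fun i => min r (a i - 1)) :
      PowerSeries (MvPolynomial (Fin n) ℂ))), Eventually.of_forall fun z => ?_, ?_⟩
  · have hy : ∀ i, (Ideal.Quotient.mk _ (MvPolynomial.X i) : TruncAlg a) ^ (a i - 1 + 1) = 0 :=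
      fun i => by rw [Nat.sub_add_cancel (ha i), truncAlg_X_pow]
    set α : MvPolynomial (Fin n) ℂ →ₐ[ℂ] TruncAlg a := MvPolynomial.aeval (R := ℂ) fun k : Fin n =>
      ∑ i, (z i ^ (k : ℕ)) • (Ideal.Quotient.mk _ (MvPolynomial.X i) : TruncAlg a)
    change (α : MvPolynomial (Fin n) ℂ →+* TruncAlg a) _ = 0
    have hαC : ∀ c : ℂ, (α : MvPolynomial (Fin n) ℂ →+* _) (MvPolynomial.C c) =
      algebraMap ℂ (TruncAlg a) c := fun c => MvPolynomial.aeval_C _ _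
    rw [← PowerSeries.coeff_map, map_mul, map_pow]
    have h1 := map_deformedSeries z _ _ hy
    change PowerSeries.map (α : MvPolynomial (Fin n) ℂ →+* TruncAlg a) (deformedSeries z) = _ at h1
    rw [h1, ← Polynomial.polynomial_map_coe, denom, Polynomial.map_prod]
    simp only [Polynomial.map_pow, Polynomial.map_sub, Polynomial.map_mul, Polynomial.map_C,
      Polynomial.map_X, Polynomial.map_one, hαC]
    have h2 := coeff_pow_mul_denom_eq_zero (fun i => algebraMap ℂ (TruncAlg a) (z i)) _ _ hy
      (r := r) (t := t) (by rwa [capSum_parts] at hrt)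
    simp_rw [← map_pow (algebraMap ℂ (TruncAlg a)), ← Algebra.smul_def] at h2
    exact h2
  · have h1 := ((deformedSeries_tendsto hl).pow r).mul
      (SeriesTendsto.denom (σ := Fin n) (z := fun z : Fin n → ℂ => z) hl fun i => min r (a i - 1))
    rw [mul_one] at h1
    exact h1 t

end LimitIdeal

/-! ### Dimensions of truncations of homogeneous ideals -/

section Dimension

open Filter Topology

variable {n : ℕ}

instance (d : ℕ) : FiniteDimensional ℂ (MvPolynomial.restrictTotalDegree (Fin n) ℂ d) := by
  have hfin : {m : Fin n →₀ ℕ | m.degree ≤ d}.Finite := Finsupp.finite_of_degree_le d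
  have : Finite {m : Fin n →₀ ℕ | m.sum (fun _ e => e) ≤ d} := hfin
  exact Module.Finite.of_basis (MvPolynomial.basisRestrictSupport ℂ _)

instance (I : Ideal (MvPolynomial (Fin n) ℂ)) (d : ℕ) : FiniteDimensional ℂ (degLE I d) :=
  Submodule.finiteDimensional_of_le inf_le_right

theorem mem_degLE {I : Ideal (MvPolynomial (Fin n) ℂ)} {d : ℕ} {p : MvPolynomial (Fin n) ℂ} :
    p ∈ degLE I d ↔ p ∈ I ∧ p.totalDegree ≤ d := by
  rw [degLE, Submodule.mem_inf, MvPolynomial.mem_restrictTotalDegree]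
  rfl

/-- The sum of the homogeneous components of degree at most `d`. -/
def truncDegree (d : ℕ) : MvPolynomial (Fin n) ℂ →ₗ[ℂ] MvPolynomial (Fin n) ℂ :=
  ∑ i ∈ Finset.range (d + 1), MvPolynomial.homogeneousComponent i

theorem truncDegree_apply (d : ℕ) (p : MvPolynomial (Fin n) ℂ) :
    truncDegree d p = ∑ i ∈ Finset.range (d + 1), MvPolynomial.homogeneousComponent i p := by
  simp [truncDegree]

theorem coeff_truncDegree (d : ℕ) (p : MvPolynomial (Fin n) ℂ) (m : Fin n →₀ ℕ) :
    (truncDegree d p).coeff m = if m.degree ≤ d then p.coeff m else 0 := by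
  simp [truncDegree_apply, MvPolynomial.coeff_sum, MvPolynomial.coeff_homogeneousComponent]

theorem totalDegree_truncDegree_le (d : ℕ) (p : MvPolynomial (Fin n) ℂ) :
    (truncDegree d p).totalDegree ≤ d := by
  rw [truncDegree_apply]
  refine MvPolynomial.totalDegree_finsetSum_le fun i hi => ?_
  exact (MvPolynomial.homogeneousComponent_isHomogeneous i p).totalDegree_le.trans
    (Nat.lt_succ_iff.1 (Finset.mem_range.1 hi))

theorem truncDegree_eq_self {d : ℕ} {p : MvPolynomial (Fin n) ℂ} (hp : p.totalDegree ≤ d) :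
    truncDegree d p = p := by
  ext m
  rw [coeff_truncDegree]
  split_ifs with hm
  · rfl
  · refine (MvPolynomial.coeff_eq_zero_of_totalDegree_lt ?_).symm
    exact hp.trans_lt (not_le.1 hm)

theorem CoeffTendsto.truncDegree {X : Type*} {l : Filter X} {q : X → MvPolynomial (Fin n) ℂ}
    {p : MvPolynomial (Fin n) ℂ} (h : CoeffTendsto q l p) (d : ℕ) :
    CoeffTendsto (fun x => truncDegree d (q x)) l (truncDegree d p) := fun m => by
  simp only [coeff_truncDegree]
  split_ifs
  · exact h m
  · exact tendsto_const_nhds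

theorem finrank_map_add_finrank_ker_inf {V N : Type*} [AddCommGroup V] [Module ℂ V]
    [AddCommGroup N] [Module ℂ N] (f : V →ₗ[ℂ] N) (P : Submodule ℂ V) [FiniteDimensional ℂ P] :
    Module.finrank ℂ (P.map f) + Module.finrank ℂ (LinearMap.ker f ⊓ P : Submodule ℂ V) =
      Module.finrank ℂ P := by
  rw [← LinearMap.finrank_range_add_finrank_ker (f.domRestrict P), LinearMap.range_domRestrict,
    LinearMap.ker_domRestrict, ← Submodule.finrank_map_subtype_eq P, Submodule.map_comap_subtype,
    inf_comm]

/-- An ideal closed under taking homogeneous components. -/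
def HomogeneousClosed (I : Ideal (MvPolynomial (Fin n) ℂ)) : Prop :=
  ∀ p ∈ I, ∀ i, MvPolynomial.homogeneousComponent i p ∈ I

theorem HomogeneousClosed.truncDegree_mem {I : Ideal (MvPolynomial (Fin n) ℂ)}
    (hI : HomogeneousClosed I) (d : ℕ) {p : MvPolynomial (Fin n) ℂ} (hp : p ∈ I) :
    truncDegree d p ∈ I := by
  rw [truncDegree_apply]
  exact I.sum_mem fun i _ => hI p hp i

/-- Splits off the elements with no component of degree at most d. This lets equality of dimensions
in a large degree D be passed down to d. -/
theorem HomogeneousClosed.finrank_degLE_add {I : Ideal (MvPolynomial (Fin n) ℂ)}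
    (hI : HomogeneousClosed I) {d D : ℕ} (hd : d ≤ D) :
    Module.finrank ℂ (degLE I d) +
      Module.finrank ℂ (LinearMap.ker (truncDegree d) ⊓ degLE I D : Submodule ℂ _) =
      Module.finrank ℂ (degLE I D) := by
  have : degLE I d = (degLE I D).map (truncDegree d) := by
    apply le_antisymm
    · intro p hp
      rw [mem_degLE] at hp
      exact ⟨p, mem_degLE.2 ⟨hp.1, hp.2.trans hd⟩, truncDegree_eq_self hp.2⟩
    · rintro _ ⟨p, hp, rfl⟩
      exact mem_degLE.2 ⟨hI.truncDegree_mem d (mem_degLE.1 hp).1, totalDegree_truncDegree_le d p⟩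
  rw [this, finrank_map_add_finrank_ker_inf]

/-- The dimension is lower semicontinuous under coefficientwise limits. -/
theorem eventually_finrank_le {X : Type*} {l : Filter X}
    (W : X → Submodule ℂ (MvPolynomial (Fin n) ℂ)) [∀ x, FiniteDimensional ℂ (W x)]
    (W₀ : Submodule ℂ (MvPolynomial (Fin n) ℂ)) [FiniteDimensional ℂ W₀]
    (h : ∀ p ∈ W₀, ∃ q : X → MvPolynomial (Fin n) ℂ, (∀ᶠ x in l, q x ∈ W x) ∧ CoeffTendsto q l p) :
    ∀ᶠ x in l, Module.finrank ℂ W₀ ≤ Module.finrank ℂ (W x) := by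
  classical
  let v := Module.finBasis ℂ W₀
  choose q hq hlim using fun i => h (v i) (v i).2
  -- Finitely many coefficients detect the independence of a basis of W₀; in this finite-dimensional
  -- space independence is an open condition.
  let M : Finset (Fin n →₀ ℕ) :=
    Finset.univ.biUnion fun i => (v i : MvPolynomial (Fin n) ℂ).support
  let ρ : MvPolynomial (Fin n) ℂ →ₗ[ℂ] (M → ℂ) :=
    LinearMap.pi fun m => MvPolynomial.lcoeff ℂ (m : Fin n →₀ ℕ)
  have hind : LinearIndependent ℂ fun i => ρ (v i) := by
    rw [Fintype.linearIndependent_iff]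
    intro g hg
    refine Fintype.linearIndependent_iff.1 v.linearIndependent g ?_
    apply Subtype.ext
    ext m
    simp only [Submodule.coe_sum, Submodule.coe_smul, MvPolynomial.coeff_sum, MvPolynomial.coeff_smul,
      ZeroMemClass.coe_zero, MvPolynomial.coeff_zero]
    by_cases hm : m ∈ M
    · have := congrFun hg ⟨m, hm⟩
      simpa [ρ] using this
    · refine Finset.sum_eq_zero fun i _ => ?_
      have : m ∉ (v i : MvPolynomial (Fin n) ℂ).support := fun h' =>
        hm (Finset.mem_biUnion.2 ⟨i, Finset.mem_univ _, h'⟩)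
      rw [MvPolynomial.notMem_support_iff.1 this, smul_zero]
  have hopen := (isOpen_setOfPred_linearIndependent (𝕜 := ℂ) (E := M → ℂ)
    (ι := Fin (Module.finrank ℂ W₀))).mem_nhds hind
  have htend : Tendsto (fun x i => ρ (q i x)) l (𝓝 fun i => ρ (v i)) :=
    tendsto_pi_nhds.2 fun i => tendsto_pi_nhds.2 fun m => hlim i m
  filter_upwards [htend hopen, eventually_all.2 hq] with x hx hqx
  have hx' : LinearIndependent ℂ fun i => ρ (q i x) := hx
  have h1 : LinearIndependent ℂ fun i => (⟨q i x, hqx i⟩ : W x) :=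
    LinearIndependent.of_comp (ρ ∘ₗ (W x).subtype) hx'
  simpa using h1.fintype_card_le_finrank

/-- Elements of W₁ ⊔ W₂ are again limits, so by semicontinuity the sum is no larger than the common
dimension of W₁ and W₂. -/
theorem grassmannTendsto_unique {X : Type*} {l : Filter X} [l.NeBot]
    {W : X → Submodule ℂ (MvPolynomial (Fin n) ℂ)} [∀ x, FiniteDimensional ℂ (W x)]
    {W₁ W₂ : Submodule ℂ (MvPolynomial (Fin n) ℂ)} [FiniteDimensional ℂ W₁]
    [FiniteDimensional ℂ W₂] (h₁ : GrassmannTendsto W l W₁) (h₂ : GrassmannTendsto W l W₂) :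
    W₁ = W₂ := by
  have hsup : ∀ᶠ x in l, Module.finrank ℂ (W₁ ⊔ W₂ : Submodule ℂ _) ≤ Module.finrank ℂ (W x) := by
    refine eventually_finrank_le W _ fun p hp => ?_
    obtain ⟨p₁, hp₁, p₂, hp₂, rfl⟩ := Submodule.mem_sup.1 hp
    obtain ⟨q₁, hq₁, hlim₁⟩ := h₁.2 p₁ hp₁
    obtain ⟨q₂, hq₂, hlim₂⟩ := h₂.2 p₂ hp₂
    exact ⟨_, (hq₁.and hq₂).mono fun x hx => add_mem hx.1 hx.2, CoeffTendsto.add hlim₁ hlim₂⟩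
  obtain ⟨x, hx, hx₁, hx₂⟩ := (hsup.and (h₁.1.and h₂.1)).exists
  rw [Submodule.eq_of_le_of_finrank_le (le_sup_left : W₁ ≤ W₁ ⊔ W₂) (hx.trans hx₁.le)]
  exact (Submodule.eq_of_le_of_finrank_le (le_sup_right : W₂ ≤ W₁ ⊔ W₂) (hx.trans hx₂.le)).symm

end Dimension

/-! ### Homogeneity -/

section Homogeneous

attribute [local instance] MvPolynomial.gradedAlgebra

variable {n : ℕ}

theorem homogeneousClosed_span {s : Set (MvPolynomial (Fin n) ℂ)}
    (hs : ∀ p ∈ s, ∃ i, MvPolynomial.IsHomogeneous p i) : HomogeneousClosed (Ideal.span s) := by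
  intro p hp i
  exact MvPolynomial.homogeneousComponent_mem_of_mem
    (Ideal.homogeneous_span (MvPolynomial.homogeneousSubmodule (Fin n) ℂ) s hs) hp i

theorem isHomogeneous_coeff_genSeries_pow (r : ℕ) : ∀ t,
    (PowerSeries.coeff t (genSeries n ^ r)).IsHomogeneous r := by
  induction r with
  | zero =>
    intro t
    rw [pow_zero, PowerSeries.coeff_one]
    split_ifs
    · exact MvPolynomial.isHomogeneous_one _ _
    · exact MvPolynomial.isHomogeneous_zero _ _ _
  | succ r ih =>
    intro t
    rw [pow_succ, PowerSeries.coeff_mul]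
    refine MvPolynomial.IsHomogeneous.sum _ _ _ fun i _ => (ih _).mul ?_
    rw [genSeries, PowerSeries.coeff_mk, truncVars_X]
    split_ifs
    · exact MvPolynomial.isHomogeneous_X _ _
    · exact MvPolynomial.isHomogeneous_zero _ _ _

theorem homogeneousClosed_limitIdeal (a : Fin n → ℕ) : HomogeneousClosed (limitIdeal a) := by
  rw [limitIdeal_eq_span]
  refine homogeneousClosed_span ?_
  rintro _ ⟨r, t, -, rfl⟩
  exact ⟨r, isHomogeneous_coeff_genSeries_pow r t⟩

/-- The substitution `e_k ↦ ∑ z_i^k y_i`. -/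
def subst (z : Fin n → ℂ) : MvPolynomial (Fin n) ℂ →ₐ[ℂ] MvPolynomial (Fin n) ℂ :=
  MvPolynomial.aeval fun k => ∑ i, z i ^ (k : ℕ) • MvPolynomial.X i

theorem isHomogeneous_powerSum (z : Fin n → ℂ) (k : ℕ) :
    (∑ i, z i ^ k • MvPolynomial.X i : MvPolynomial (Fin n) ℂ).IsHomogeneous 1 := by
  refine MvPolynomial.IsHomogeneous.sum _ _ _ fun i _ => ?_
  rw [MvPolynomial.smul_eq_C_mul]
  exact MvPolynomial.isHomogeneous_C_mul_X _ _

theorem mem_idealI {a : Fin n → ℕ} {z : Fin n → ℂ} {p : MvPolynomial (Fin n) ℂ} :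
    p ∈ idealI a z ↔
      subst z p ∈ Ideal.span (Set.range fun i => (MvPolynomial.X i : MvPolynomial (Fin n) ℂ) ^ a i) := by
  rw [idealI, RingHom.mem_ker, ← Ideal.Quotient.eq_zero_iff_mem, subst]
  have : (Ideal.Quotient.mkₐ ℂ (Ideal.span (Set.range fun i =>
      (MvPolynomial.X i : MvPolynomial (Fin n) ℂ) ^ a i))).comp (subst z) =
      MvPolynomial.aeval (R := ℂ) fun k : Fin n => ∑ i, (z i ^ (k : ℕ)) •
        (Ideal.Quotient.mk _ (MvPolynomial.X i) : TruncAlg a) := by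
    ext k
    simp only [subst, AlgHom.comp_apply, MvPolynomial.aeval_X, map_sum, map_smul]
    rfl
  rw [← this]
  rfl

theorem homogeneousComponent_subst (z : Fin n → ℂ) (i : ℕ) (p : MvPolynomial (Fin n) ℂ) :
    MvPolynomial.homogeneousComponent i (subst z p) =
      subst z (MvPolynomial.homogeneousComponent i p) := by
  induction p using MvPolynomial.induction_on' with
  | monomial d c =>
    have h1 : (subst z (MvPolynomial.monomial d c)).IsHomogeneous d.degree := by
      have := (MvPolynomial.isHomogeneous_monomial c (rfl : d.degree = d.degree)).aeval
        (fun k : Fin n => ∑ i, z i ^ (k : ℕ) • (MvPolynomial.X i : MvPolynomial (Fin n) ℂ))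
        (fun k => isHomogeneous_powerSum z k)
      rwa [one_mul] at this
    rw [MvPolynomial.homogeneousComponent_of_mem h1,
      MvPolynomial.homogeneousComponent_of_mem (MvPolynomial.isHomogeneous_monomial c rfl)]
    split_ifs
    · rfl
    · rw [map_zero]
  | add p q hp hq => simp only [map_add, hp, hq]

/-- The substitution is by linear forms, hence preserves degree, and the target ideal is generated
by monomials. -/
theorem homogeneousClosed_idealI (a : Fin n → ℕ) (z : Fin n → ℂ) :
    HomogeneousClosed (idealI a z) := by
  intro p hp i
  rw [mem_idealI] at hp ⊢
  rw [← homogeneousComponent_subst]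
  refine homogeneousClosed_span ?_ _ hp i
  rintro _ ⟨j, rfl⟩
  exact ⟨_, MvPolynomial.isHomogeneous_X_pow j (a j)⟩

end Homogeneous

/-! ### Existence and uniqueness of the limit -/

section Limit

open Filter Topology

variable {n : ℕ}

/-- Solves for y_i in terms of the power sums ∑ z_j^k y_j, k < n; this is where distinctness of the
coordinates enters. -/
theorem exists_vandermonde_inverse {z : Fin n → ℂ} (hz : Function.Injective z) :
    ∃ c : Fin n → Fin n → ℂ, ∀ i j, ∑ k, c i k * z j ^ (k : ℕ) = if i = j then 1 else 0 := by
  have hdet : IsUnit (Matrix.vandermonde z).det :=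
    isUnit_iff_ne_zero.2 (Matrix.det_vandermonde_ne_zero_iff.2 hz)
  refine ⟨fun i k => (Matrix.vandermonde z)⁻¹ k i, fun i j => ?_⟩
  have h1 := congrFun (congrFun (Matrix.mul_nonsing_inv _ hdet) j) i
  rw [Matrix.mul_apply, Matrix.one_apply] at h1
  simp_rw [eq_comm (a := i), ← h1]
  exact Finset.sum_congr rfl fun k _ => by rw [Matrix.vandermonde_apply, mul_comm]

/-- The exponent of the monomial `∏ y_i^{α_i}`. -/
def exponent {a : Fin n → ℕ} (α : ∀ i, Fin (a i)) : Fin n →₀ ℕ :=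
  Finsupp.equivFunOnFinite.symm fun i => (α i : ℕ)

theorem prod_X_pow_exponent {a : Fin n → ℕ} (α : ∀ i, Fin (a i)) :
    ∏ i, (MvPolynomial.X i : MvPolynomial (Fin n) ℂ) ^ (α i : ℕ) =
      MvPolynomial.monomial (exponent α) 1 := by
  rw [MvPolynomial.monomial_eq, MvPolynomial.C_1, one_mul, Finsupp.prod_fintype _ _ fun _ => pow_zero _]
  rfl

theorem exponent_injective {a : Fin n → ℕ} :
    Function.Injective (exponent : (∀ i, Fin (a i)) → (Fin n →₀ ℕ)) := fun α β h => by
  funext i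
  exact Fin.ext (DFunLike.congr_fun h i)

theorem linearIndependent_truncAlg (a : Fin n → ℕ) :
    LinearIndependent ℂ fun α : ∀ i, Fin (a i) =>
      (Ideal.Quotient.mk _ (MvPolynomial.monomial (exponent α) 1) : TruncAlg a) := by
  classical
  rw [Fintype.linearIndependent_iff]
  intro g hg α
  have h1 : (Ideal.Quotient.mkₐ ℂ (Ideal.span (Set.range fun i =>
      (MvPolynomial.X i : MvPolynomial (Fin n) ℂ) ^ a i)))
      (∑ α, g α • MvPolynomial.monomial (exponent α) 1) = 0 := by
    rw [map_sum]
    simp only [map_smul]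
    exact hg
  have h2 : Set.range (fun i => (MvPolynomial.X i : MvPolynomial (Fin n) ℂ) ^ a i) =
      (fun s => MvPolynomial.monomial s (1 : ℂ)) '' Set.range fun i => Finsupp.single i (a i) := by
    rw [← Set.range_comp]
    exact congrArg Set.range (funext fun i => MvPolynomial.X_pow_eq_monomial)
  have h3 := Ideal.Quotient.eq_zero_iff_mem.1 h1
  rw [h2, MvPolynomial.mem_ideal_span_monomial_image] at h3
  by_contra hα
  have hcoeff : (∑ β, g β • MvPolynomial.monomial (exponent β) (1 : ℂ)).coeff (exponent α) = g α := by
    simp [MvPolynomial.coeff_sum, MvPolynomial.coeff_monomial, exponent_injective.eq_iff]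
  obtain ⟨_, ⟨i, rfl⟩, hi⟩ := h3 (exponent α) (by
    rw [MvPolynomial.mem_support_iff, hcoeff]; exact hα)
  have := hi i
  rw [Finsupp.single_eq_same] at this
  exact absurd (α i).2 (not_lt.2 this)

theorem subst_linearForm {z : Fin n → ℂ} {c : Fin n → Fin n → ℂ}
    (hc : ∀ i j, ∑ k, c i k * z j ^ (k : ℕ) = if i = j then 1 else 0) (i : Fin n) :
    subst z (∑ k, c i k • MvPolynomial.X k) = MvPolynomial.X i := by
  simp only [subst, map_sum, map_smul, MvPolynomial.aeval_X, Finset.smul_sum, smul_smul]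
  rw [Finset.sum_comm]
  simp only [← Finset.sum_smul, hc, ite_smul, one_smul, zero_smul]
  simp

/-- Once d ≥ ∑ a_i, polynomials of degree at most d already reach all the ∏ a_i independent
monomials of the truncated algebra. -/
theorem finrank_degLE_idealI_add_le (a : Fin n → ℕ) {z : Fin n → ℂ} (hz : Function.Injective z)
    {d : ℕ} (hd : ∑ i, a i ≤ d) :
    Module.finrank ℂ (degLE (idealI a z) d) + ∏ i, a i ≤
      Module.finrank ℂ (MvPolynomial.restrictTotalDegree (Fin n) ℂ d) := by
  obtain ⟨c, hc⟩ := exists_vandermonde_inverse hz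
  let f : MvPolynomial (Fin n) ℂ →ₗ[ℂ] TruncAlg a :=
    ((Ideal.Quotient.mkₐ ℂ _).comp (subst z)).toLinearMap
  have hker : degLE (idealI a z) d =
      LinearMap.ker f ⊓ MvPolynomial.restrictTotalDegree (Fin n) ℂ d := by
    rw [degLE]
    congr 1
    ext p
    exact mem_idealI.trans Ideal.Quotient.eq_zero_iff_mem.symm
  rw [hker, ← finrank_map_add_finrank_ker_inf f (MvPolynomial.restrictTotalDegree (Fin n) ℂ d),
    add_comm]
  refine Nat.add_le_add_right ?_ _
  have hmem : ∀ α : ∀ i, Fin (a i),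
      (Ideal.Quotient.mk _ (MvPolynomial.monomial (exponent α) 1) : TruncAlg a) ∈
        (MvPolynomial.restrictTotalDegree (Fin n) ℂ d).map f := fun α => by
    -- The i-th inverse Vandermonde combination of the e_k is a preimage of y_i.
    refine ⟨∏ i, (∑ k, c i k • MvPolynomial.X k) ^ (α i : ℕ), ?_, ?_⟩
    · rw [SetLike.mem_coe, MvPolynomial.mem_restrictTotalDegree]
      refine (MvPolynomial.totalDegree_finsetProd _ _).trans (le_trans ?_ hd)
      refine Finset.sum_le_sum fun i _ => (MvPolynomial.totalDegree_pow _ _).trans ?_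
      have h1 : (∑ k, c i k • MvPolynomial.X k : MvPolynomial (Fin n) ℂ).totalDegree ≤ 1 :=
        MvPolynomial.totalDegree_finsetSum_le fun k _ =>
          (MvPolynomial.totalDegree_smul_le _ _).trans (MvPolynomial.totalDegree_X k).le
      exact (Nat.mul_le_mul_left _ h1).trans (by have := (α i).2; omega)
    · change Ideal.Quotient.mk _ (subst z _) = _
      rw [map_prod]
      simp only [map_pow, subst_linearForm hc]
      rw [prod_X_pow_exponent]
  have hind : LinearIndependent ℂ fun α : ∀ i, Fin (a i) =>
      (⟨_, hmem α⟩ : (MvPolynomial.restrictTotalDegree (Fin n) ℂ d).map f) :=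
    LinearIndependent.of_comp (Submodule.subtype _) (linearIndependent_truncAlg a)
  simpa [Fintype.card_pi] using hind.fintype_card_le_finrank

theorem rank_quotient_limitIdeal_le (a : Fin n → ℕ) (ha : ∀ i, 0 < a i) :
    Module.rank ℂ (MvPolynomial (Fin n) ℂ ⧸ limitIdeal a) ≤ (∏ i, a i : ℕ) := by
  rw [← prod_parts a ha]
  refine le_trans ?_ (rank_quotient_relIdeal_le (parts a))
  let q : MvPolynomial ℕ ℂ →ₗ[ℂ] MvPolynomial (Fin n) ℂ ⧸ limitIdeal a :=
    ((Ideal.Quotient.mkₐ ℂ (limitIdeal a)).comp (truncVars n)).toLinearMap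
  have hq : (relIdeal (parts a)).restrictScalars ℂ ≤ LinearMap.ker q := fun p hp =>
    Ideal.Quotient.eq_zero_iff_mem.2 (Ideal.mem_map_of_mem _ hp)
  have hs : Function.Surjective (((relIdeal (parts a)).restrictScalars ℂ).liftQ q hq) := by
    rw [← LinearMap.range_eq_top, Submodule.range_liftQ, LinearMap.range_eq_top]
    exact Ideal.Quotient.mk_surjective.comp (truncVars_surjective n)
  exact LinearMap.rank_le_of_surjective _ hs

theorem finite_quotient_limitIdeal (a : Fin n → ℕ) (ha : ∀ i, 0 < a i) :
    Module.Finite ℂ (MvPolynomial (Fin n) ℂ ⧸ limitIdeal a) :=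
  Module.rank_lt_aleph0_iff.1 ((rank_quotient_limitIdeal_le a ha).trans_lt (Cardinal.natCast_lt_aleph0))

theorem finrank_quotient_limitIdeal_le (a : Fin n → ℕ) (ha : ∀ i, 0 < a i) :
    Module.finrank ℂ (MvPolynomial (Fin n) ℂ ⧸ limitIdeal a) ≤ ∏ i, a i :=
  Module.finrank_le_of_rank_le (rank_quotient_limitIdeal_le a ha)

theorem le_finrank_degLE_limitIdeal_add (a : Fin n → ℕ) (ha : ∀ i, 0 < a i) (d : ℕ) :
    Module.finrank ℂ (MvPolynomial.restrictTotalDegree (Fin n) ℂ d) ≤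
      Module.finrank ℂ (degLE (limitIdeal a) d) + ∏ i, a i := by
  have := finite_quotient_limitIdeal a ha
  let f : MvPolynomial (Fin n) ℂ →ₗ[ℂ] MvPolynomial (Fin n) ℂ ⧸ limitIdeal a :=
    (Ideal.Quotient.mkₐ ℂ (limitIdeal a)).toLinearMap
  have hker : degLE (limitIdeal a) d =
      LinearMap.ker f ⊓ MvPolynomial.restrictTotalDegree (Fin n) ℂ d := by
    rw [degLE]
    congr 1
    ext p
    exact Ideal.Quotient.eq_zero_iff_mem.symm
  rw [hker, ← finrank_map_add_finrank_ker_inf f (MvPolynomial.restrictTotalDegree (Fin n) ℂ d),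
    add_comm]
  exact Nat.add_le_add_left ((Submodule.finrank_le _).trans (finrank_quotient_limitIdeal_le a ha)) _

/-- Semicontinuity gives one inequality of dimensions. The other comes from a degree D large enough
for the codimension ∏ a_i to be visible, and homogeneity carries it back to d. -/
theorem isLimitIdeal_limitIdeal (a : Fin n → ℕ) (ha : ∀ i, 0 < a i) :
    IsLimitIdeal a (limitIdeal a) := by
  intro d
  have hlim : ∀ d, ∀ p ∈ degLE (limitIdeal a) d, ∃ q : (Fin n → ℂ) → MvPolynomial (Fin n) ℂ,
      (∀ᶠ z in 𝓝[{z | Function.Injective z}] 0, q z ∈ degLE (idealI a z) d) ∧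
        CoeffTendsto q (𝓝[{z | Function.Injective z}] 0) p := by
    intro d p hp
    rw [mem_degLE] at hp
    obtain ⟨q, hq, hqp⟩ := limitIdeal_le_idealOfLimits a ha (nhdsWithin_le_nhds) hp.1
    refine ⟨fun z => truncDegree d (q z), hq.mono fun z hz => mem_degLE.2
      ⟨(homogeneousClosed_idealI a z).truncDegree_mem d hz, totalDegree_truncDegree_le d _⟩, ?_⟩
    have := CoeffTendsto.truncDegree hqp d
    rwa [truncDegree_eq_self hp.2] at this
  refine ⟨?_, hlim d⟩
  set D := max d (∑ i, a i)
  have h1 := eventually_finrank_le (fun z => degLE (idealI a z) d) _ (hlim d)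
  have h2 := eventually_finrank_le (fun z => degLE (idealI a z) D) _ (hlim D)
  have h3 : ∀ᶠ z in 𝓝[{z : Fin n → ℂ | Function.Injective z}] 0,
      Module.finrank ℂ (LinearMap.ker (truncDegree d) ⊓ degLE (limitIdeal a) D : Submodule ℂ _) ≤
      Module.finrank ℂ (LinearMap.ker (truncDegree d) ⊓ degLE (idealI a z) D : Submodule ℂ _) := by
    refine eventually_finrank_le _ _ fun p hp => ?_
    obtain ⟨q, hq, hqp⟩ := hlim D p hp.2
    -- Subtracting the part of degree at most d puts the approximants in the kernel; the limit is
    -- unchanged because p has no such part.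
    refine ⟨fun z => q z + (-1 : ℂ) • truncDegree d (q z), hq.mono fun z hz => ⟨?_, ?_⟩, ?_⟩
    · rw [SetLike.mem_coe, LinearMap.mem_ker, map_add, map_smul,
        truncDegree_eq_self (totalDegree_truncDegree_le d (q z)), neg_one_smul, add_neg_cancel]
    · refine Submodule.add_mem _ hz (Submodule.smul_mem _ _ (mem_degLE.2 ⟨?_, ?_⟩))
      · exact (homogeneousClosed_idealI a z).truncDegree_mem d (mem_degLE.1 hz).1
      · exact (totalDegree_truncDegree_le d _).trans (le_max_left _ _)
    · have h4 := hqp.add ((CoeffTendsto.const (MvPolynomial.C (-1))).mul (hqp.truncDegree d))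
      rw [LinearMap.mem_ker.1 hp.1, mul_zero, add_zero] at h4
      exact h4.congr_left fun z => by rw [MvPolynomial.smul_eq_C_mul]
  filter_upwards [h1, h2, h3, self_mem_nhdsWithin] with z h1 h2 h3 hz
  -- Both summands of the dimension in degree D are at least those of the limit, while their total
  -- is at most that of the limit. Hence both inequalities are equalities.
  have h4 := finrank_degLE_idealI_add_le a hz (le_max_right d (∑ i, a i))
  have h5 := le_finrank_degLE_limitIdeal_add a ha D
  have h6 := (homogeneousClosed_idealI a z).finrank_degLE_add (le_max_left d (∑ i, a i))
  have h7 := (homogeneousClosed_limitIdeal a).finrank_degLE_add (le_max_left d (∑ i, a i))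
  change _ + Module.finrank ℂ (LinearMap.ker (truncDegree d) ⊓ degLE (idealI a z) D :
    Submodule ℂ _) = Module.finrank ℂ (degLE (idealI a z) D) at h6
  change _ + Module.finrank ℂ (LinearMap.ker (truncDegree d) ⊓ degLE (limitIdeal a) D :
    Submodule ℂ _) = Module.finrank ℂ (degLE (limitIdeal a) D) at h7
  change Module.finrank ℂ (degLE (idealI a z) D) + _ ≤ Module.finrank ℂ
    (MvPolynomial.restrictTotalDegree (Fin n) ℂ D) at h4
  omega

instance : (𝓝[{z : Fin n → ℂ | Function.Injective z}] 0).NeBot := by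
  -- The points c (0, 1, …, n - 1) with c ≠ 0 approach the origin with distinct coordinates.
  have h1 : Tendsto (fun (c : ℂ) (i : Fin n) => c * ((i : ℕ) : ℂ)) (𝓝[≠] 0)
      (𝓝[{z : Fin n → ℂ | Function.Injective z}] 0) := by
    refine tendsto_nhdsWithin_iff.2 ⟨?_, ?_⟩
    · have h2 : Continuous fun (c : ℂ) (i : Fin n) => c * ((i : ℕ) : ℂ) := by fun_prop
      have h3 := h2.tendsto 0
      simp only [zero_mul] at h3
      exact h3.mono_left nhdsWithin_le_nhds
    · filter_upwards [self_mem_nhdsWithin] with c hc i j hij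
      have := mul_left_cancel₀ hc hij
      exact Fin.ext (by exact_mod_cast this)
  exact h1.neBot

theorem isLimitIdeal_unique {a : Fin n → ℕ} {I J : Ideal (MvPolynomial (Fin n) ℂ)}
    (hI : IsLimitIdeal a I) (hJ : IsLimitIdeal a J) : I = J := by
  ext p
  have h1 := grassmannTendsto_unique (hI p.totalDegree) (hJ p.totalDegree)
  have h2 : ∀ K : Ideal (MvPolynomial (Fin n) ℂ), p ∈ K ↔ p ∈ degLE K p.totalDegree := fun K => by
    rw [mem_degLE, and_iff_left le_rfl]
  rw [h2, h2 J, h1]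

end Limit

/-! ### Irreducible representations of `sl_2` -/

section Sl2

theorem coe_e : (e : Matrix (Fin 2) (Fin 2) ℂ) = !![0, 1; 0, 0] := by
  change Matrix.single 0 1 1 = _
  ext i j
  fin_cases i <;> fin_cases j <;> simp [Matrix.single]

theorem coe_f : (f : Matrix (Fin 2) (Fin 2) ℂ) = !![0, 0; 1, 0] := by
  change Matrix.single 1 0 1 = _
  ext i j
  fin_cases i <;> fin_cases j <;> simp [Matrix.single]

theorem coe_lie_e_f : (⁅e, f⁆ : sl2).1 = !![1, 0; 0, -1] := by
  rw [LieAlgebra.SpecialLinear.sl_bracket, coe_e, coe_f]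
  ext i j
  fin_cases i <;> fin_cases j <;> simp

theorem isSl2Triple : IsSl2Triple ⁅e, f⁆ e f where
  h_ne_zero := by
    intro h
    have h1 := congrArg Subtype.val h
    rw [coe_lie_e_f] at h1
    simpa using congrFun (congrFun h1 0) 0
  lie_e_f := rfl
  lie_h_e_nsmul := by
    apply Subtype.ext
    change _ = 2 • e.1
    rw [LieAlgebra.SpecialLinear.sl_bracket, coe_lie_e_f, coe_e]
    ext i j
    fin_cases i <;> fin_cases j <;> simp [one_add_one_eq_two]
  lie_h_f_nsmul := by
    apply Subtype.ext
    change _ = -(2 • f.1)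
    rw [LieAlgebra.SpecialLinear.sl_bracket, coe_lie_e_f, coe_f]
    ext i j
    fin_cases i <;> fin_cases j <;> simp
    norm_num

theorem sl2_eq_combination (x : sl2) :
    x = x.1 0 1 • e + x.1 1 0 • f + x.1 0 0 • ⁅e, f⁆ := by
  have htr : x.1 0 0 + x.1 1 1 = 0 := by
    have : Matrix.trace x.1 = 0 := LinearMap.mem_ker.1 x.2
    simpa [Matrix.trace, Fin.sum_univ_two] using this
  apply Subtype.ext
  change x.1 = x.1 0 1 • e.1 + x.1 1 0 • f.1 + x.1 0 0 • (⁅e, f⁆ : sl2).1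
  rw [coe_lie_e_f, coe_e, coe_f]
  ext i j
  fin_cases i <;> fin_cases j <;> simp
  exact eq_neg_of_add_eq_zero_right htr

variable {M : Type u} [AddCommGroup M] [Module ℂ M] [LieRingModule sl2 M] [LieModule ℂ sl2 M]

/-- The symmetric triple exchanges e and f and negates h, so a primitive vector is killed by f and e
moves it. Its nonzero translates are eigenvectors of -h with distinct eigenvalues. -/
theorem linearIndependent_pow_primitive {m : M} {μ : ℂ} {N : ℕ}
    (P : isSl2Triple.symm.HasPrimitiveVectorWith m μ) (hN : μ = N) :
    LinearIndependent ℂ fun j : Fin (N + 1) => (LieModule.toEnd ℂ sl2 M e ^ (j : ℕ)) m := by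
  refine Module.End.eigenvectors_linearIndependent' (LieModule.toEnd ℂ sl2 M (-⁅e, f⁆))
    (fun j : Fin (N + 1) => μ - 2 * (j : ℕ)) (fun i j hij => ?_) _ fun j => ?_
  · simpa [Fin.ext_iff] using hij
  · rw [Module.End.hasEigenvector_iff, Module.End.mem_eigenspace_iff]
    exact ⟨P.lie_h_pow_toEnd_f j, P.pow_toEnd_f_ne_zero_of_eq_nat hN (Nat.lt_succ_iff.1 j.2)⟩

variable [LieModule.IsIrreducible ℂ sl2 M]

/-- The span is stable under e, f and h, hence a nonzero submodule of an irreducible module. -/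
theorem span_pow_primitive_eq_top {m : M} {μ : ℂ}
    (P : isSl2Triple.symm.HasPrimitiveVectorWith m μ) :
    Submodule.span ℂ (Set.range fun j : ℕ => (LieModule.toEnd ℂ sl2 M e ^ j) m) = ⊤ := by
  set S := Submodule.span ℂ (Set.range fun j : ℕ => (LieModule.toEnd ℂ sl2 M e ^ j) m)
  have hmem : ∀ j, (LieModule.toEnd ℂ sl2 M e ^ j) m ∈ S := fun j => Submodule.subset_span ⟨j, rfl⟩
  have hcl : ∀ x : sl2, (∀ j, ⁅x, (LieModule.toEnd ℂ sl2 M e ^ j) m⁆ ∈ S) → ∀ v ∈ S, ⁅x, v⁆ ∈ S := by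
    intro x hx v hv
    have hle : S ≤ S.comap (LieModule.toEnd ℂ sl2 M x) := by
      refine Submodule.span_le.2 ?_
      rintro _ ⟨j, rfl⟩
      exact hx j
    exact hle hv
  have he := hcl e fun j => by
    rw [P.lie_f_pow_toEnd_f]
    exact hmem _
  have hh := hcl ⁅e, f⁆ fun j => by
    have h1 := P.lie_h_pow_toEnd_f j
    rw [neg_lie, neg_eq_iff_eq_neg] at h1
    rw [h1]
    exact S.neg_mem (S.smul_mem _ (hmem _))
  have hf := hcl f fun j => by
    cases j with
    | zero =>
      rw [pow_zero, Module.End.one_apply, P.lie_e]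
      exact S.zero_mem
    | succ j =>
      rw [P.lie_e_pow_succ_toEnd_f]
      exact S.smul_mem _ (hmem _)
  let N : LieSubmodule ℂ sl2 M :=
    { S with
      lie_mem := by
        intro x v hv
        rw [sl2_eq_combination x, add_lie, add_lie, smul_lie, smul_lie, smul_lie]
        exact S.add_mem (S.add_mem (S.smul_mem _ (he v hv)) (S.smul_mem _ (hf v hv)))
          (S.smul_mem _ (hh v hv)) }
  have hN : N = ⊤ := by
    refine (eq_bot_or_eq_top N).resolve_left fun hbot => P.ne_zero ?_
    have h1 : m ∈ N := hmem 0
    rw [hbot] at h1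
    exact (LieSubmodule.mem_bot _).1 h1
  exact congrArg LieSubmodule.toSubmodule hN

variable [FiniteDimensional ℂ M]

theorem exists_basis_of_primitive {m : M} {μ : ℂ}
    (P : isSl2Triple.symm.HasPrimitiveVectorWith m μ) :
    ∃ (N : ℕ) (b : Module.Basis (Fin (N + 1)) ℂ M), μ = N ∧
      (∀ j, b j = (LieModule.toEnd ℂ sl2 M e ^ (j : ℕ)) m) ∧
      (LieModule.toEnd ℂ sl2 M e ^ (N + 1)) m = 0 := by
  obtain ⟨N, hN⟩ := P.exists_nat
  have h0 : (LieModule.toEnd ℂ sl2 M e ^ (N + 1)) m = 0 := P.pow_toEnd_f_eq_zero_of_eq_nat hN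
  refine ⟨N, Module.Basis.mk (linearIndependent_pow_primitive P hN) ?_, hN,
    fun j => Module.Basis.mk_apply _ _ j, h0⟩
  rw [← span_pow_primitive_eq_top P]
  refine Submodule.span_le.2 ?_
  rintro _ ⟨j, rfl⟩
  rcases lt_or_ge j (N + 1) with hj | hj
  · exact Submodule.subset_span ⟨⟨j, hj⟩, rfl⟩
  · obtain ⟨k, rfl⟩ := Nat.exists_eq_add_of_le' hj
    rw [SetLike.mem_coe]
    beta_reduce
    rw [pow_add, Module.End.mul_apply, h0, map_zero]
    exact Submodule.zero_mem _

/-- A vector killed by f is not assumed to be a weight vector. Expanding it in the basis e^j m of a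
primitive vector m, with f e^{j+1} m = (j + 1)(μ - j) e^j m and nonzero factors for j < N, shows
that it is a multiple of m. -/
theorem IsHighestVector.exists_basis {v : M} (hv : IsHighestVector v) :
    ∃ b : Module.Basis (Fin (Module.finrank ℂ M)) ℂ M,
      (∀ j, b j = (LieModule.toEnd ℂ sl2 M e ^ (j : ℕ)) v) ∧
      (LieModule.toEnd ℂ sl2 M e ^ Module.finrank ℂ M) v = 0 := by
  have : Nontrivial M := ⟨v, 0, hv.1⟩
  obtain ⟨μ, m, -, P⟩ := IsSl2Triple.exists_hasPrimitiveVectorWith (R := ℂ) (M := M) isSl2Triple.symm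
  obtain ⟨N, b, hN, hb, -⟩ := exists_basis_of_primitive P
  have hv' : v = b.repr v 0 • m := by
    have h1 := b.sum_repr v
    rw [Fin.sum_univ_succ, hb 0, Fin.val_zero, pow_zero, Module.End.one_apply] at h1
    have h2 : ⁅f, v⁆ = 0 := hv.2
    rw [← h1, lie_add, lie_smul, P.lie_e, smul_zero, zero_add, lie_sum] at h2
    have h3 : ∑ j : Fin N, (b.repr v j.succ * (((j : ℕ) + 1) * (μ - (j : ℕ)))) • b j.castSucc = 0 := by
      rw [← h2]
      refine Finset.sum_congr rfl fun j _ => ?_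
      rw [lie_smul, hb, hb, Fin.val_succ, P.lie_e_pow_succ_toEnd_f, smul_smul, Fin.val_castSucc]
    have h4 := Fintype.linearIndependent_iff.1
      (b.linearIndependent.comp Fin.castSucc (Fin.castSucc_injective N)) _ h3
    have h5 : ∀ j : Fin N, b.repr v j.succ = 0 := fun j => by
      refine (mul_eq_zero.1 (h4 j)).resolve_right (mul_ne_zero (Nat.cast_add_one_ne_zero _) ?_)
      rw [hN, sub_ne_zero]
      exact_mod_cast j.2.ne'
    simp only [h5, zero_smul, Finset.sum_const_zero, add_zero] at h1
    exact h1.symm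
  have Pv : isSl2Triple.symm.HasPrimitiveVectorWith v μ :=
    { ne_zero := hv.1
      lie_h := by rw [hv', lie_smul, P.lie_h, smul_comm]
      lie_e := hv.2 }
  obtain ⟨N, b, -, hb, h0⟩ := exists_basis_of_primitive Pv
  have hcard : Module.finrank ℂ M = N + 1 := by simpa using Module.finrank_eq_card_basis b
  rw [hcard]
  exact ⟨b, hb, h0⟩

end Sl2

/-! ### The tensor product as a cyclic module over a polynomial ring -/

section Cyclic

/-- The kernel of a linear map from a polynomial ring, as an ideal when it is stable under
multiplication by the variables. -/
def kerIdeal {σ N : Type*} [AddCommMonoid N] [Module ℂ N] (g : MvPolynomial σ ℂ →ₗ[ℂ] N)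
    (h : ∀ i p, g p = 0 → g (MvPolynomial.X i * p) = 0) : Ideal (MvPolynomial σ ℂ) where
  __ := LinearMap.ker g
  smul_mem' := by
    intro c p hp
    change g (c * p) = 0
    replace hp : g p = 0 := hp
    induction c using MvPolynomial.induction_on generalizing p with
    | C a => rw [← MvPolynomial.smul_eq_C_mul, map_smul, hp, smul_zero]
    | add c c' hc hc' => rw [add_mul, map_add, hc hp, hc' hp, add_zero]
    | mul_X c i hc => rw [mul_assoc]; exact hc (h i p hp)

theorem mem_kerIdeal {σ N : Type*} [AddCommMonoid N] [Module ℂ N] {g : MvPolynomial σ ℂ →ₗ[ℂ] N}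
    {h : ∀ i p, g p = 0 → g (MvPolynomial.X i * p) = 0} {p : MvPolynomial σ ℂ} :
    p ∈ kerIdeal g h ↔ g p = 0 := Iff.rfl

variable {n : ℕ} {π : Fin n → Type u} [∀ i, AddCommGroup (π i)] [∀ i, Module ℂ (π i)]
  [∀ i, LieRingModule sl2 (π i)] [∀ i, LieModule ℂ sl2 (π i)]

/-- The action of `e` on the `i`-th tensor factor. -/
def factorE (π : Fin n → Type u) [∀ i, AddCommGroup (π i)] [∀ i, Module ℂ (π i)]
    [∀ i, LieRingModule sl2 (π i)] [∀ i, LieModule ℂ sl2 (π i)] (i : Fin n) :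
    Module.End ℂ (⨂[ℂ] i, π i) :=
  atFactor π i (LieModule.toEnd ℂ sl2 (π i) e)

theorem eOp_eq_sum (z : Fin n → ℂ) (k : ℕ) : eOp π z k = ∑ i, z i ^ k • factorE π i := by
  change (∑ i, atFactor π i ∘ₗ (evalRep (π i) (z i)).toLinearMap) (eCur k) = _
  rw [LinearMap.sum_apply]
  refine Finset.sum_congr rfl fun i _ => ?_
  have h1 : evalHom (z i) (eCur k) = z i ^ k • e := by
    change (TensorProduct.lid ℂ sl2) (TensorProduct.map (Polynomial.aeval (z i)).toLinearMap
      LinearMap.id ((Polynomial.X ^ k : Polynomial ℂ) ⊗ₜ[ℂ] e)) = _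
    simp
  change atFactor π i (LieModule.toEnd ℂ sl2 (π i) (evalHom (z i) (eCur k))) = _
  rw [h1, map_smul, map_smul, factorE]

theorem factorE_tprod (i : Fin n) (v : ∀ i, π i) :
    factorE π i (PiTensorProduct.tprod ℂ v) =
      PiTensorProduct.tprod ℂ (Function.update v i ⁅e, v i⁆) := by
  change PiTensorProduct.map (Function.update (fun _ => LinearMap.id) i _) _ = _
  rw [PiTensorProduct.map_tprod]
  congr 1
  ext j
  rcases eq_or_ne j i with rfl | hj
  · simp
  · simp [hj]

/-- The map `ℂ[y_1, …, y_n] → π_1 ⊗ ⋯ ⊗ π_n` that sends `p` to `p` applied to the cyclic vector,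
where `y_i` acts as `e` on the `i`-th factor. -/
def orbitMap (u : ∀ i, π i) : MvPolynomial (Fin n) ℂ →ₗ[ℂ] ⨂[ℂ] i, π i :=
  (MvPolynomial.basisMonomials (Fin n) ℂ).constr ℂ fun α =>
    PiTensorProduct.tprod ℂ fun i => (LieModule.toEnd ℂ sl2 (π i) e ^ α i) (u i)

theorem orbitMap_monomial (u : ∀ i, π i) (α : Fin n →₀ ℕ) :
    orbitMap u (MvPolynomial.monomial α 1) =
      PiTensorProduct.tprod ℂ fun i => (LieModule.toEnd ℂ sl2 (π i) e ^ α i) (u i) := by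
  have h := congrFun (MvPolynomial.coe_basisMonomials (Fin n) ℂ) α
  beta_reduce at h
  rw [← h, orbitMap, Module.Basis.constr_basis]

theorem orbitMap_one (u : ∀ i, π i) : orbitMap u 1 = PiTensorProduct.tprod ℂ u := by
  have := orbitMap_monomial u 0
  simpa using this

theorem orbitMap_X_mul (u : ∀ i, π i) (i : Fin n) (p : MvPolynomial (Fin n) ℂ) :
    orbitMap u (MvPolynomial.X i * p) = factorE π i (orbitMap u p) := by
  have h : orbitMap u ∘ₗ LinearMap.mulLeft ℂ (MvPolynomial.X i) = factorE π i ∘ₗ orbitMap u := by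
    refine (MvPolynomial.basisMonomials (Fin n) ℂ).ext fun α => ?_
    rw [MvPolynomial.coe_basisMonomials]
    simp only [LinearMap.comp_apply, LinearMap.mulLeft_apply]
    rw [MvPolynomial.X, MvPolynomial.monomial_mul, one_mul, orbitMap_monomial, orbitMap_monomial,
      factorE_tprod]
    congr 1
    ext j
    rcases eq_or_ne j i with rfl | hj
    · simp [pow_add]
    · simp [hj, Finsupp.single_eq_of_ne hj]
  exact LinearMap.congr_fun h p

theorem orbitMap_powerSum_mul (u : ∀ i, π i) (z : Fin n → ℂ) (k : ℕ)
    (p : MvPolynomial (Fin n) ℂ) :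
    orbitMap u ((∑ i, z i ^ k • MvPolynomial.X i) * p) = eOp π z k (orbitMap u p) := by
  rw [eOp_eq_sum, Finset.sum_mul, map_sum, LinearMap.sum_apply]
  refine Finset.sum_congr rfl fun i _ => ?_
  rw [smul_mul_assoc, map_smul, orbitMap_X_mul, LinearMap.smul_apply]

variable [∀ i, FiniteDimensional ℂ (π i)] [∀ i, LieModule.IsIrreducible ℂ sl2 (π i)]
  {a : Fin n → ℕ} {u : ∀ i, π i}

/-- The kernel is an ideal, and y_i^{a_i} is in it because e^{a_i} u_i = 0 when dim π_i = a_i. -/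
theorem orbitMap_eq_zero (ha : ∀ i, Module.finrank ℂ (π i) = a i) (hu : ∀ i, IsHighestVector (u i))
    {p : MvPolynomial (Fin n) ℂ}
    (hp : p ∈ Ideal.span (Set.range fun i => (MvPolynomial.X i : MvPolynomial (Fin n) ℂ) ^ a i)) :
    orbitMap u p = 0 := by
  have h : ∀ i p, orbitMap u p = 0 → orbitMap u (MvPolynomial.X i * p) = 0 := fun i p hp => by
    rw [orbitMap_X_mul, hp, map_zero]
  refine (mem_kerIdeal (h := h)).1 (Ideal.span_le.2 ?_ hp)
  rintro _ ⟨i, rfl⟩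
  obtain ⟨-, -, h0⟩ := (hu i).exists_basis
  simp only
  rw [SetLike.mem_coe, mem_kerIdeal, MvPolynomial.X_pow_eq_monomial, orbitMap_monomial]
  refine (PiTensorProduct.tprod ℂ).map_coord_zero i ?_
  rw [Finsupp.single_eq_same, ← ha i, h0]

theorem exists_basis_tensor (ha : ∀ i, Module.finrank ℂ (π i) = a i)
    (hu : ∀ i, IsHighestVector (u i)) :
    ∃ b : Module.Basis (∀ i, Fin (a i)) ℂ (⨂[ℂ] i, π i),
      ∀ α, b α = orbitMap u (MvPolynomial.monomial (exponent α) 1) := by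
  have h : ∀ i, ∃ b : Module.Basis (Fin (a i)) ℂ (π i),
      ∀ j, b j = (LieModule.toEnd ℂ sl2 (π i) e ^ (j : ℕ)) (u i) := fun i => by
    obtain ⟨b, hb, -⟩ := (hu i).exists_basis
    rw [← ha i]
    exact ⟨b, hb⟩
  choose b hb using h
  refine ⟨Basis.piTensorProduct b, fun α => ?_⟩
  rw [Basis.piTensorProduct_apply, orbitMap_monomial]
  congr 1
  ext i
  exact hb i (α i)

theorem finrank_tensor (ha : ∀ i, Module.finrank ℂ (π i) = a i)
    (hu : ∀ i, IsHighestVector (u i)) : Module.finrank ℂ (⨂[ℂ] i, π i) = ∏ i, a i := by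
  obtain ⟨b, -⟩ := exists_basis_tensor ha hu
  rw [Module.finrank_eq_card_basis b, Fintype.card_pi]
  simp

theorem finite_tensor (ha : ∀ i, Module.finrank ℂ (π i) = a i)
    (hu : ∀ i, IsHighestVector (u i)) : Module.Finite ℂ (⨂[ℂ] i, π i) := by
  obtain ⟨b, -⟩ := exists_basis_tensor ha hu
  exact Module.Finite.of_basis b

theorem range_orbitMap (ha : ∀ i, Module.finrank ℂ (π i) = a i)
    (hu : ∀ i, IsHighestVector (u i)) : LinearMap.range (orbitMap u) = ⊤ := by
  obtain ⟨b, hb⟩ := exists_basis_tensor ha hu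
  rw [eq_top_iff, ← b.span_eq, Submodule.span_le]
  rintro _ ⟨α, rfl⟩
  exact ⟨_, (hb α).symm⟩

end Cyclic

/-! ### The fusion product as a cyclic module -/

section FusionCyclic

/-- A surjection onto a space at least as large is bijective. The dimension hypothesis is
conditional because finiteness of N itself comes from the surjection. -/
theorem exists_equiv_quotient {R N : Type*} [CommRing R] [Algebra ℂ R] [AddCommMonoid N]
    [Module ℂ N] (g : R →ₗ[ℂ] N) (I : Ideal R) (hI : ∀ p ∈ I, g p = 0) (hg : Function.Surjective g)
    [Module.Finite ℂ (R ⧸ I)]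
    (h : Module.Finite ℂ N → Module.finrank ℂ (R ⧸ I) ≤ Module.finrank ℂ N) :
    ∃ Φ : N ≃ₗ[ℂ] (R ⧸ I), ∀ p, Φ (g p) = Ideal.Quotient.mk I p := by
  let : AddCommGroup N := Module.addCommMonoidToAddCommGroup ℂ
  let G : (R ⧸ I) →ₗ[ℂ] N := (I.restrictScalars ℂ).liftQ g hI
  have hG : ∀ p, G (Ideal.Quotient.mk I p) = g p := fun p => rfl
  have hsurj : Function.Surjective G := fun x => by
    obtain ⟨p, rfl⟩ := hg x
    exact ⟨_, hG p⟩
  have hfin : Module.Finite ℂ N := Module.Finite.of_surjective G hsurj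
  have hinj : Function.Injective G := (LinearMap.injective_iff_surjective_of_finrank_eq_finrank
    (le_antisymm (h hfin) (LinearMap.finrank_le_finrank_of_surjective hsurj))).2 hsurj
  refine ⟨(LinearEquiv.ofBijective G ⟨hinj, hsurj⟩).symm, fun p => ?_⟩
  rw [LinearEquiv.symm_apply_eq]
  rfl

theorem finsupp_induction_add_single {σ : Type*} {P : (σ →₀ ℕ) → Prop} (h0 : P 0)
    (h : ∀ i α, P α → P (Finsupp.single i 1 + α)) (α : σ →₀ ℕ) : P α := by
  induction α using Finsupp.induction with
  | zero => exact h0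
  | single_add i b α _ _ ih =>
    induction b with
    | zero => simpa using ih
    | succ b ihb =>
      rw [add_comm b, Finsupp.single_add, add_assoc]
      by_cases hb : b = 0
      · subst hb
        simpa using h i α ih
      · exact h i _ (ihb hb)

/-- The weight of a monomial, where `e_k` has weight `k`. -/
abbrev weight (α : ℕ →₀ ℕ) : ℕ := Finsupp.weight (id : ℕ → ℕ) α

theorem weight_single_add (k : ℕ) (α : ℕ →₀ ℕ) :
    weight (Finsupp.single k 1 + α) = weight α + k := by
  rw [weight, map_add, Finsupp.weight_single]
  simp [add_comm]

open MvPolynomial in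
theorem isWeightedHomogeneous_coeff_mk_X_pow (r : ℕ) : ∀ t,
    IsWeightedHomogeneous (id : ℕ → ℕ)
      (PowerSeries.coeff t (PowerSeries.mk (X : ℕ → MvPolynomial ℕ ℂ) ^ r)) t := by
  induction r with
  | zero =>
    intro t
    rw [pow_zero, PowerSeries.coeff_one]
    split_ifs with ht
    · rw [ht]; exact isWeightedHomogeneous_one _ _
    · exact isWeightedHomogeneous_zero _ _ _
  | succ r ih =>
    intro t
    rw [pow_succ, PowerSeries.coeff_mul]
    refine (weightedHomogeneousSubmodule ℂ (id : ℕ → ℕ) t).sum_mem fun i hi => ?_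
    rw [PowerSeries.coeff_mk, ← Finset.HasAntidiagonal.mem_antidiagonal.1 hi]
    exact (ih i.1).mul (isWeightedHomogeneous_X ℂ (id : ℕ → ℕ) i.2)

variable {n : ℕ} {π : Fin n → Type u} [∀ i, AddCommGroup (π i)] [∀ i, Module ℂ (π i)]
  [∀ i, LieRingModule sl2 (π i)] [∀ i, LieModule ℂ sl2 (π i)]

theorem filt_mono (z : Fin n → ℂ) (u : ∀ i, π i) : Monotone (filt z u) := fun s t hst => by
  refine Submodule.span_mono ?_
  rintro w ⟨L, hL, rfl⟩
  exact ⟨L, hL.trans hst, rfl⟩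

/-- The map `ℂ[e_0, e_1, …] → π_1 ⊗ ⋯ ⊗ π_n` that sends `p` to `p` applied to the cyclic vector. -/
def currentOrbit (z : Fin n → ℂ) (u : ∀ i, π i) : MvPolynomial ℕ ℂ →ₗ[ℂ] ⨂[ℂ] i, π i :=
  orbitMap u ∘ₗ (MvPolynomial.aeval fun k : ℕ => ∑ i, z i ^ k • MvPolynomial.X i :
    MvPolynomial ℕ ℂ →ₐ[ℂ] MvPolynomial (Fin n) ℂ).toLinearMap

theorem currentOrbit_one (z : Fin n → ℂ) (u : ∀ i, π i) :
    currentOrbit z u 1 = PiTensorProduct.tprod ℂ u := by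
  rw [currentOrbit, LinearMap.comp_apply, AlgHom.toLinearMap_apply, map_one, orbitMap_one]

theorem currentOrbit_X_mul (z : Fin n → ℂ) (u : ∀ i, π i) (k : ℕ) (p : MvPolynomial ℕ ℂ) :
    currentOrbit z u (MvPolynomial.X k * p) = eOp π z k (currentOrbit z u p) := by
  rw [currentOrbit, LinearMap.comp_apply, AlgHom.toLinearMap_apply, map_mul, MvPolynomial.aeval_X,
    orbitMap_powerSum_mul]
  rfl

theorem X_mul_monomial (k : ℕ) (α : ℕ →₀ ℕ) : MvPolynomial.X k * MvPolynomial.monomial α (1 : ℂ) =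
    MvPolynomial.monomial (Finsupp.single k 1 + α) 1 := by
  rw [MvPolynomial.X, MvPolynomial.monomial_mul, one_mul]

theorem currentOrbit_monomial_mem (z : Fin n → ℂ) (u : ∀ i, π i) (α : ℕ →₀ ℕ) :
    currentOrbit z u (MvPolynomial.monomial α 1) ∈ filt z u (weight α) := by
  induction α using finsupp_induction_add_single with
  | h0 =>
    refine Submodule.subset_span ⟨[], by simp, ?_⟩
    have := currentOrbit_one z u
    simpa using this
  | h k α ih =>
    rw [← X_mul_monomial, currentOrbit_X_mul, weight_single_add]
    exact eOp_mem_filt z u k _ _ ih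

/-- The class of an element of `F_s` in the component of degree `s` of the fusion product. -/
def toFusion (z : Fin n → ℂ) (u : ∀ i, π i) (s : ℕ) : filt z u s →ₗ[ℂ] FusionProduct z u :=
  DirectSum.lof ℂ ℕ (GrPiece z u) s ∘ₗ ((filtPrev z u s).submoduleOf (filt z u s)).mkQ

theorem toFusion_congr (z : Fin n → ℂ) (u : ∀ i, π i) {s t : ℕ} (h : s = t) {v w : ⨂[ℂ] i, π i}
    (hv : v ∈ filt z u s) (hw : w ∈ filt z u t) (hvw : v = w) :
    toFusion z u s ⟨v, hv⟩ = toFusion z u t ⟨w, hw⟩ := by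
  subst h hvw
  rfl

theorem toFusion_eq_zero (z : Fin n → ℂ) (u : ∀ i, π i) {s : ℕ} {w : filt z u s}
    (h : (w : ⨂[ℂ] i, π i) ∈ filtPrev z u s) : toFusion z u s w = 0 := by
  have : ((filtPrev z u s).submoduleOf (filt z u s)).mkQ w = 0 :=
    (Submodule.Quotient.mk_eq_zero _).2 h
  rw [toFusion, LinearMap.comp_apply, this, map_zero]

theorem fusionE_toFusion (z : Fin n → ℂ) (u : ∀ i, π i) (k s : ℕ) (w : filt z u s) :
    fusionE z u k (toFusion z u s w) =
      toFusion z u (s + k) ⟨eOp π z k w, eOp_mem_filt z u k s w w.2⟩ := by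
  rw [fusionE, toFusion, LinearMap.comp_apply, DirectSum.toModule_lof]
  rfl

/-- The map `ℂ[e_0, e_1, …] → FusionProduct` that sends `p` to `p` applied to the class of the
cyclic vector. -/
def fusionOrbit (z : Fin n → ℂ) (u : ∀ i, π i) : MvPolynomial ℕ ℂ →ₗ[ℂ] FusionProduct z u :=
  (MvPolynomial.basisMonomials ℕ ℂ).constr ℂ fun α =>
    toFusion z u (weight α) ⟨_, currentOrbit_monomial_mem z u α⟩

theorem fusionOrbit_monomial (z : Fin n → ℂ) (u : ∀ i, π i) (α : ℕ →₀ ℕ) :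
    fusionOrbit z u (MvPolynomial.monomial α 1) =
      toFusion z u (weight α) ⟨_, currentOrbit_monomial_mem z u α⟩ := by
  have h := congrFun (MvPolynomial.coe_basisMonomials ℕ ℂ) α
  beta_reduce at h
  exact (congrArg _ h.symm).trans (Module.Basis.constr_basis _ _ _ _)

theorem fusionOrbit_X_mul (z : Fin n → ℂ) (u : ∀ i, π i) (k : ℕ) (p : MvPolynomial ℕ ℂ) :
    fusionOrbit z u (MvPolynomial.X k * p) = fusionE z u k (fusionOrbit z u p) := by
  have h : fusionOrbit z u ∘ₗ LinearMap.mulLeft ℂ (MvPolynomial.X k) =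
      fusionE z u k ∘ₗ fusionOrbit z u := by
    refine (MvPolynomial.basisMonomials ℕ ℂ).ext fun α => ?_
    rw [MvPolynomial.coe_basisMonomials]
    simp only [LinearMap.comp_apply, LinearMap.mulLeft_apply]
    rw [X_mul_monomial, fusionOrbit_monomial, fusionOrbit_monomial, fusionE_toFusion]
    refine toFusion_congr z u (weight_single_add k α) _ _ ?_
    rw [← X_mul_monomial, currentOrbit_X_mul]
  exact LinearMap.congr_fun h p

/-- On elements of pure weight t the graded action is computed in the tensor product and then
reduced modulo F_{t-1}. -/
theorem fusionOrbit_of_isWeightedHomogeneous (z : Fin n → ℂ) (u : ∀ i, π i) {t : ℕ}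
    {p : MvPolynomial ℕ ℂ} (hp : MvPolynomial.IsWeightedHomogeneous (id : ℕ → ℕ) p t) :
    ∃ h : currentOrbit z u p ∈ filt z u t, fusionOrbit z u p = toFusion z u t ⟨_, h⟩ := by
  have hp' : p ∈ MvPolynomial.restrictSupport ℂ {α | weight α = t} := fun α hα =>
    hp (MvPolynomial.mem_support_iff.1 hα)
  rw [MvPolynomial.restrictSupport_eq_span] at hp'
  clear hp
  induction hp' using Submodule.span_induction with
  | mem p hp =>
    obtain ⟨α, rfl, rfl⟩ := hp
    exact ⟨currentOrbit_monomial_mem z u α, fusionOrbit_monomial z u α⟩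
  | zero =>
    refine ⟨by rw [map_zero]; exact zero_mem _, ?_⟩
    rw [map_zero, toFusion_eq_zero]
    simp only [map_zero]
    exact zero_mem _
  | add p q _ _ hp hq =>
    obtain ⟨hp, hp'⟩ := hp
    obtain ⟨hq, hq'⟩ := hq
    refine ⟨by rw [map_add]; exact add_mem hp hq, ?_⟩
    rw [map_add, hp', hq', ← map_add]
    exact toFusion_congr z u rfl _ _ (map_add _ _ _).symm
  | smul c p _ hp =>
    obtain ⟨hp, hp'⟩ := hp
    refine ⟨by rw [map_smul]; exact Submodule.smul_mem _ _ hp, ?_⟩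
    rw [map_smul, hp', ← map_smul]
    exact toFusion_congr z u rfl _ _ (map_smul _ _ _).symm

theorem list_prod_eOp (z : Fin n → ℂ) (u : ∀ i, π i) (L : List ℕ) :
    ∃ α : ℕ →₀ ℕ, weight α = L.sum ∧ (L.map (eOp π z)).prod (PiTensorProduct.tprod ℂ u) =
      currentOrbit z u (MvPolynomial.monomial α 1) := by
  induction L with
  | nil =>
    refine ⟨0, by simp, ?_⟩
    have := (currentOrbit_one z u).symm
    simpa using this
  | cons k L ih =>
    obtain ⟨α, hα, h⟩ := ih
    refine ⟨Finsupp.single k 1 + α, ?_, ?_⟩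
    · rw [weight_single_add, hα, List.sum_cons, add_comm]
    · rw [← X_mul_monomial, currentOrbit_X_mul, ← h, List.map_cons, List.prod_cons]
      rfl

/-- Among the spanning vectors of F_s, those of weight exactly s are images of monomials, and those
of smaller weight vanish in the graded piece. -/
theorem fusionOrbit_surjective (z : Fin n → ℂ) (u : ∀ i, π i) :
    Function.Surjective (fusionOrbit z u) := by
  rw [← LinearMap.range_eq_top, eq_top_iff]
  have key : ∀ s, ∀ w ∈ filt z u s, ∀ hw : w ∈ filt z u s,
      toFusion z u s ⟨w, hw⟩ ∈ LinearMap.range (fusionOrbit z u) := by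
    intro s w hw'
    have hle : filt z u s ≤
        ((LinearMap.range (fusionOrbit z u)).comap (toFusion z u s)).map (filt z u s).subtype := by
      refine Submodule.span_le.2 ?_
      rintro _ ⟨L, hL, rfl⟩
      obtain ⟨α, hα, h⟩ := list_prod_eOp z u L
      rw [SetLike.mem_coe, h]
      have hmem := currentOrbit_monomial_mem z u α
      refine ⟨⟨_, filt_mono z u (hα.trans_le hL) hmem⟩, ?_, rfl⟩
      rw [SetLike.mem_coe, Submodule.mem_comap]
      rcases hL.eq_or_lt with hs | hs
      · exact ⟨MvPolynomial.monomial α 1, (fusionOrbit_monomial z u α).trans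
          (toFusion_congr z u (hα.trans hs) _ _ rfl)⟩
      · rw [toFusion_eq_zero]
        · exact zero_mem _
        · cases s with
          | zero => omega
          | succ s => exact filt_mono z u (by omega : weight α ≤ s) hmem
    intro hw
    obtain ⟨v, hv, rfl⟩ := hle hw'
    exact hv
  intro x _
  induction x using DirectSum.induction_on with
  | zero => exact zero_mem _
  | of s y =>
    obtain ⟨w, rfl⟩ := Submodule.mkQ_surjective _ y
    exact key s w w.2 w.2
  | add x y hx hy => exact add_mem (hx trivial) (hy trivial)

variable [∀ i, FiniteDimensional ℂ (π i)] [∀ i, LieModule.IsIrreducible ℂ sl2 (π i)]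
  {a : Fin n → ℕ} {u : ∀ i, π i}

/-- Rationality gives a linear recurrence on u for the coefficients of e(T)^r, with leading
coefficient 1 since the denominator has constant term 1. -/
theorem currentOrbit_coeff_mem_filtPrev (ha : ∀ i, Module.finrank ℂ (π i) = a i)
    (hpos : ∀ i, 0 < a i) (hu : ∀ i, IsHighestVector (u i)) (z : Fin n → ℂ) {r t : ℕ}
    (hrt : capSum (parts a) r < t + r) :
    currentOrbit z u (PowerSeries.coeff t
      (PowerSeries.mk (MvPolynomial.X : ℕ → MvPolynomial ℕ ℂ) ^ r)) ∈ filtPrev z u t := by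
  set η : MvPolynomial ℕ ℂ →ₐ[ℂ] MvPolynomial (Fin n) ℂ :=
    MvPolynomial.aeval fun k : ℕ => ∑ i, z i ^ k • MvPolynomial.X i with hη
  set G : ℕ → MvPolynomial ℕ ℂ := fun t => PowerSeries.coeff t
    (PowerSeries.mk (MvPolynomial.X : ℕ → MvPolynomial ℕ ℂ) ^ r)
  set c : ℕ → ℂ := (denom z fun i => min r (a i - 1)).coeff
  set q : MvPolynomial (Fin n) ℂ →ₐ[ℂ] TruncAlg a := Ideal.Quotient.mkₐ ℂ (Ideal.span (Set.range fun i =>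
    (MvPolynomial.X i : MvPolynomial (Fin n) ℂ) ^ a i))
  have hy : ∀ i, q (MvPolynomial.X i) ^ (a i - 1 + 1) = 0 := fun i => by
    rw [Nat.sub_add_cancel (hpos i)]
    exact truncAlg_X_pow a i
  have h1 := coeff_pow_mul_denom_eq_zero (fun i => algebraMap ℂ (TruncAlg a) (z i)) _ _ hy
    (r := r) (t := t) (by rwa [capSum_parts] at hrt)
  have hden : denom (fun i => algebraMap ℂ (TruncAlg a) (z i)) (fun i => min r (a i - 1)) =
      (denom z fun i => min r (a i - 1)).map (algebraMap ℂ (TruncAlg a)) := by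
    rw [denom, denom, Polynomial.map_prod]
    simp
  have hG : ∀ s, PowerSeries.coeff s ((PowerSeries.mk fun k =>
      ∑ i, algebraMap ℂ (TruncAlg a) (z i) ^ k * q (MvPolynomial.X i)) ^ r) = q (η (G s)) := by
    intro s
    have h2 := map_coeff_mk_X_pow (q.comp η).toRingHom r s
    refine Eq.trans ?_ h2.symm
    congr 3
    funext k
    change _ = q (η (MvPolynomial.X k))
    rw [hη, MvPolynomial.aeval_X, map_sum]
    exact Finset.sum_congr rfl fun i _ => by
      rw [map_smul, ← map_pow]; exact (Algebra.smul_def _ _).symm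
  have h2 : q (η (∑ i ∈ Finset.HasAntidiagonal.antidiagonal t, c i.2 • G i.1)) = 0 := by
    rw [PowerSeries.coeff_mul] at h1
    rw [map_sum, map_sum, ← h1]
    refine Finset.sum_congr rfl fun i _ => ?_
    rw [map_smul, map_smul, hG, Polynomial.coeff_coe, hden, Polynomial.coeff_map, mul_comm]
    exact Algebra.smul_def (c i.2) (q (η (G i.1)))
  have h3 : currentOrbit z u (∑ i ∈ Finset.HasAntidiagonal.antidiagonal t, c i.2 • G i.1) = 0 :=
    orbitMap_eq_zero ha hu (Ideal.Quotient.eq_zero_iff_mem.1 h2)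
  have hc0 : c 0 = 1 := coeff_zero_denom _ _
  cases t with
  | zero =>
    rw [Finset.Nat.antidiagonal_zero, Finset.sum_singleton, hc0, one_smul] at h3
    rw [h3]
    exact zero_mem _
  | succ t =>
    -- The coefficient of T^{t+1} becomes a combination of coefficients of T^s with s ≤ t, which act
    -- on u with values in F_t.
    rw [Finset.Nat.sum_antidiagonal_succ', map_add, hc0, one_smul] at h3
    rw [eq_neg_of_add_eq_zero_left h3, map_sum]
    refine neg_mem (sum_mem fun i hi => ?_)
    rw [map_smul]
    refine Submodule.smul_mem _ _ (filt_mono z u ?_ (fusionOrbit_of_isWeightedHomogeneous z u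
      (isWeightedHomogeneous_coeff_mk_X_pow r i.1)).1)
    have := Finset.HasAntidiagonal.mem_antidiagonal.1 hi
    omega

theorem fusionOrbit_eq_zero (ha : ∀ i, Module.finrank ℂ (π i) = a i)
    (hpos : ∀ i, 0 < a i) (hu : ∀ i, IsHighestVector (u i)) (z : Fin n → ℂ)
    {p : MvPolynomial ℕ ℂ} (hp : p ∈ relIdeal (parts a)) : fusionOrbit z u p = 0 := by
  have h : ∀ k p, fusionOrbit z u p = 0 → fusionOrbit z u (MvPolynomial.X k * p) = 0 :=
    fun k p hp => by rw [fusionOrbit_X_mul, hp, map_zero]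
  refine (mem_kerIdeal (h := h)).1 (Ideal.span_le.2 ?_ hp)
  rintro _ ⟨r, t, hrt, rfl⟩
  rw [SetLike.mem_coe, mem_kerIdeal]
  obtain ⟨hmem, heq⟩ := fusionOrbit_of_isWeightedHomogeneous z u
    (isWeightedHomogeneous_coeff_mk_X_pow r t)
  rw [heq]
  exact toFusion_eq_zero z u (currentOrbit_coeff_mem_filtPrev ha hpos hu z hrt)

/-- The generators e_k with k ≥ n already lie in the relation ideal, so passing to n variables loses
nothing. -/
theorem rename_truncVars_sub_mem (a : Fin n → ℕ) (p : MvPolynomial ℕ ℂ) :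
    MvPolynomial.rename Fin.val (truncVars n p) - p ∈ relIdeal (parts a) := by
  rw [← Ideal.Quotient.eq_zero_iff_mem, map_sub, sub_eq_zero]
  have h : ((Ideal.Quotient.mkₐ ℂ (relIdeal (parts a))).comp
      ((MvPolynomial.rename Fin.val).comp (truncVars n))) =
      Ideal.Quotient.mkₐ ℂ (relIdeal (parts a)) := by
    ext k
    rw [AlgHom.comp_apply, AlgHom.comp_apply, truncVars_X]
    split_ifs with hk
    · rw [MvPolynomial.rename_X]
    · rw [map_zero, map_zero]
      exact (((relIdeal_le_iff _ _).1 le_rfl).eq_zero (by rw [card_parts]; omega)).symm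
  exact DFunLike.congr_fun h p

/-- By Vandermonde, e acting on a single factor is a combination of e_0, …, e_{n-1}, and these
single-factor operators generate the tensor product from u. -/
theorem iSup_filt_eq_top (ha : ∀ i, Module.finrank ℂ (π i) = a i)
    (hu : ∀ i, IsHighestVector (u i)) {z : Fin n → ℂ} (hz : Function.Injective z) :
    ⨆ s, filt z u s = ⊤ := by
  obtain ⟨c, hc⟩ := exists_vandermonde_inverse hz
  have hmem : ∀ v, v ∈ ⨆ s, filt z u s ↔ ∃ s, v ∈ filt z u s := fun v =>
    Submodule.mem_iSup_of_directed _ (filt_mono z u).directed_le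
  have hfac : ∀ i, factorE π i = ∑ k : Fin n, c i k • eOp π z k := fun i => by
    simp only [eOp_eq_sum, Finset.smul_sum, smul_smul]
    rw [Finset.sum_comm]
    simp only [← Finset.sum_smul, hc, ite_smul, one_smul, zero_smul]
    simp
  rw [eq_top_iff, ← range_orbitMap ha hu]
  have key : ∀ α, orbitMap u (MvPolynomial.monomial α 1) ∈ ⨆ s, filt z u s := by
    intro α
    induction α using finsupp_induction_add_single with
    | h0 =>
      refine (hmem _).2 ⟨0, ?_⟩
      have h1 := currentOrbit_monomial_mem z u 0
      have h2 : currentOrbit z u (MvPolynomial.monomial 0 1) = orbitMap u (MvPolynomial.monomial 0 1) := by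
        rw [← MvPolynomial.one_def, ← MvPolynomial.one_def, currentOrbit_one, orbitMap_one]
      rw [h2] at h1
      simpa using h1
    | h i α ih =>
      have h1 : MvPolynomial.monomial (Finsupp.single i 1 + α) (1 : ℂ) =
          MvPolynomial.X i * MvPolynomial.monomial α 1 := by
        rw [MvPolynomial.X, MvPolynomial.monomial_mul, one_mul]
      rw [h1, orbitMap_X_mul, hfac, LinearMap.sum_apply]
      obtain ⟨s, hs⟩ := (hmem _).1 ih
      refine sum_mem fun k _ => ?_
      rw [LinearMap.smul_apply]
      exact Submodule.smul_mem _ _ ((hmem _).2 ⟨s + k, eOp_mem_filt z u k s _ hs⟩)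
  rintro _ ⟨p, rfl⟩
  rw [← MvPolynomial.support_sum_monomial_coeff p, map_sum]
  refine sum_mem fun α _ => ?_
  rw [← mul_one (p.coeff α), ← smul_eq_mul, ← MvPolynomial.smul_monomial, map_smul]
  exact Submodule.smul_mem _ _ (key α)

/-- The dimensions of the graded pieces telescope to that of F_N, which is the whole tensor product
once the filtration has stabilized. -/
theorem prod_le_finrank_fusionProduct (ha : ∀ i, Module.finrank ℂ (π i) = a i)
    (hu : ∀ i, IsHighestVector (u i)) {z : Fin n → ℂ} (hz : Function.Injective z)
    [Module.Finite ℂ (FusionProduct z u)] :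
    ∏ i, a i ≤ Module.finrank ℂ (FusionProduct z u) := by
  have := finite_tensor ha hu
  have hsum : ∀ s, ∑ t ∈ Finset.range (s + 1), Module.finrank ℂ (GrPiece z u t) =
      Module.finrank ℂ (filt z u s) := by
    have hstep : ∀ s, filtPrev z u s ≤ filt z u s → Module.finrank ℂ (GrPiece z u s) +
        Module.finrank ℂ (filtPrev z u s) = Module.finrank ℂ (filt z u s) := fun s hs => by
      rw [← Submodule.finrank_quotient_add_finrank ((filtPrev z u s).submoduleOf (filt z u s)),
        (Submodule.submoduleOfEquivOfLe hs).finrank_eq]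
    intro s
    induction s with
    | zero =>
      have h1 := hstep 0 bot_le
      have h2 : Module.finrank ℂ (filtPrev z u 0) = 0 := finrank_bot ℂ _
      rw [zero_add, Finset.sum_range_one]
      omega
    | succ s ih =>
      have h1 := hstep (s + 1) (filt_mono z u (Nat.le_succ s))
      change _ + Module.finrank ℂ (filt z u s) = _ at h1
      rw [Finset.sum_range_succ, ih]
      omega
  obtain ⟨N, hN⟩ := WellFoundedGT.monotone_chain_condition (⟨filt z u, filt_mono z u⟩ : ℕ →o _)
  have htop : filt z u N = ⊤ := by
    rw [← iSup_filt_eq_top ha hu hz]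
    refine le_antisymm (le_iSup _ N) (iSup_le fun s => ?_)
    rcases le_total s N with hs | hs
    · exact filt_mono z u hs
    · exact (hN s hs).ge
  have hfree : ∀ t, Module.Free ℂ (GrPiece z u t) := fun t => inferInstance
  have h1 := hsum N
  rw [htop, finrank_top, finrank_tensor ha hu, ← Finset.sum_coe_sort] at h1
  rw [← h1, ← Module.finrank_pi_fintype]
  exact LinearMap.finrank_le_finrank_of_injective
    (f := DirectSum.lmk ℂ ℕ (GrPiece z u) (Finset.range (N + 1))) (DirectSum.mk_injective _)

theorem exists_fusionProduct_equiv (ha : ∀ i, Module.finrank ℂ (π i) = a i)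
    (hpos : ∀ i, 0 < a i) (hu : ∀ i, IsHighestVector (u i)) {z : Fin n → ℂ}
    (hz : Function.Injective z) :
    ∃ Φ : FusionProduct z u ≃ₗ[ℂ] (MvPolynomial (Fin n) ℂ ⧸ limitIdeal a),
      ∀ (k : Fin n) (x : FusionProduct z u), Φ (fusionE z u (k : ℕ) x) =
        Ideal.Quotient.mk (limitIdeal a) (MvPolynomial.X k) * Φ x := by
  let g : MvPolynomial (Fin n) ℂ →ₗ[ℂ] FusionProduct z u :=
    fusionOrbit z u ∘ₗ (MvPolynomial.rename Fin.val).toLinearMap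
  have hg : ∀ p, g (truncVars n p) = fusionOrbit z u p := fun p => by
    change fusionOrbit z u (MvPolynomial.rename Fin.val (truncVars n p)) = _
    rw [← sub_add_cancel (MvPolynomial.rename Fin.val (truncVars n p)) p, map_add,
      fusionOrbit_eq_zero ha hpos hu z (rename_truncVars_sub_mem a p), zero_add]
  have hker : ∀ p ∈ limitIdeal a, g p = 0 := by
    intro p hp
    obtain ⟨q, hq, rfl⟩ := (Ideal.mem_map_iff_of_surjective _ (truncVars_surjective n)).1 hp
    exact (hg q).trans (fusionOrbit_eq_zero ha hpos hu z hq)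
  have hsurj : Function.Surjective g := fun x => by
    obtain ⟨p, rfl⟩ := fusionOrbit_surjective z u x
    exact ⟨truncVars n p, hg p⟩
  have := finite_quotient_limitIdeal a hpos
  obtain ⟨Φ, hΦ⟩ := exists_equiv_quotient g (limitIdeal a) hker hsurj fun hfin =>
    (finrank_quotient_limitIdeal_le a hpos).trans (prod_le_finrank_fusionProduct ha hu hz)
  refine ⟨Φ, fun k x => ?_⟩
  obtain ⟨p, rfl⟩ := hsurj x
  have hX : fusionE z u k (g p) = g (MvPolynomial.X k * p) := by
    simp only [g, LinearMap.comp_apply, AlgHom.toLinearMap_apply, map_mul, MvPolynomial.rename_X]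
    rw [fusionOrbit_X_mul]
  rw [hX, hΦ, hΦ, map_mul]

end FusionCyclic

end Fusion

end

/-! ### The theorem -/

theorem theorem3p1 {n : ℕ} (a : Fin n → ℕ) (ha : ∀ i, 0 < a i) :
    (∃! I₀ : Ideal (MvPolynomial (Fin n) ℂ), Fusion.IsLimitIdeal a I₀) ∧
    ∀ I₀ : Ideal (MvPolynomial (Fin n) ℂ), Fusion.IsLimitIdeal a I₀ →
    ∀ (π : Fin n → Type*) [∀ i, AddCommGroup (π i)] [∀ i, Module ℂ (π i)]
      [∀ i, LieRingModule Fusion.sl2 (π i)] [∀ i, LieModule ℂ Fusion.sl2 (π i)]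
      [∀ i, FiniteDimensional ℂ (π i)] [∀ i, LieModule.IsIrreducible ℂ Fusion.sl2 (π i)],
    (∀ i, Module.finrank ℂ (π i) = a i) →
    ∀ u : ∀ i, π i, (∀ i, Fusion.IsHighestVector (u i)) →
    (∀ z : Fin n → ℂ, Function.Injective z →
      ∃ Φ : Fusion.FusionProduct z u ≃ₗ[ℂ] (MvPolynomial (Fin n) ℂ ⧸ I₀),
        ∀ (k : Fin n) (x : Fusion.FusionProduct z u),
          Φ (Fusion.fusionE z u (k : ℕ) x) =
            Ideal.Quotient.mk I₀ (MvPolynomial.X k) * Φ x) ∧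
    (∀ z z' : Fin n → ℂ, Function.Injective z → Function.Injective z' →
      ∃ Ψ : Fusion.FusionProduct z u ≃ₗ[ℂ] Fusion.FusionProduct z' u,
        ∀ (k : Fin n) (x : Fusion.FusionProduct z u),
          Ψ (Fusion.fusionE z u (k : ℕ) x) = Fusion.fusionE z' u (k : ℕ) (Ψ x)) := by
  refine ⟨⟨_, Fusion.isLimitIdeal_limitIdeal a ha, fun J hJ =>
    Fusion.isLimitIdeal_unique hJ (Fusion.isLimitIdeal_limitIdeal a ha)⟩, ?_⟩
  intro I₀ hI₀ π _ _ _ _ _ _ hπ u hu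
  obtain rfl := Fusion.isLimitIdeal_unique hI₀ (Fusion.isLimitIdeal_limitIdeal a ha)
  refine ⟨fun z hz => Fusion.exists_fusionProduct_equiv hπ ha hu hz, fun z z' hz hz' => ?_⟩
  obtain ⟨Φ, hΦ⟩ := Fusion.exists_fusionProduct_equiv hπ ha hu hz
  obtain ⟨Φ', hΦ'⟩ := Fusion.exists_fusionProduct_equiv hπ ha hu hz'
  -- Both fusion products are identified with the same quotient, which does not involve z or z'.
  refine ⟨Φ.trans Φ'.symm, fun k x => ?_⟩
  rw [LinearEquiv.trans_apply, LinearEquiv.trans_apply, LinearEquiv.symm_apply_eq, hΦ, hΦ',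
    LinearEquiv.apply_symm_apply]
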